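/- Let $T>0$, $\gamma_0<0<\gamma_2$, let $\xi\in C^1([0,T])$ with $\xi(0)=0$, and put $K=\xi(T)$, $$V_1=\{(x,t): 0<t<T,\ x<\xi(t)\},\qquad V_2=\{(x,t): 0<t<T,\ x>\xi(t)\}.$$ A regular solution of $u_t=\gamma u_{xx}$ in $V_i$ is a bounded function $u\in C^{2,1}(V_i)\cap C(\overline V_i)$ that satisfies the equation in $V_i$, whose derivative $u_x$ is bounded in $V_i$, and for which the one-sided limit of $u_x(x,t)$ as $x\to\xi(t)$ from inside $V_i$ exists and is finite for every $t\in(0,T)$; this limit is written $u_x(\xi(t),t)$. For a curve $\zeta$ put $$\mathcal K_\zeta(s,\tau)=\frac{\sqrt\pi}{2}\,\frac{\zeta(\tau)-\zeta(s)}{\tau-s}\,\frac{e^{-\frac{(\zeta(\tau)-\zeta(s))^2}{4(\tau-s)}}}{(\tau-s)^{1/2}},\qquad 0<s<\tau .$$ **(a) Forward problem.** Let $u_0\in C^1([0,\infty))$ with $u_0'\in L^1((0,\infty))$, let $g_0^+\in C^1([0,T])$, and let $u^+$ be a regular solution of $$u_t=\gamma_2u_{xx}\ \text{in } V_2,\qquad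 u(\xi(t),t)=g_0^+(t)\ \text{for } 0<t<T,\qquad u(x,0)=u_0(x)\ \text{for } x>0 .$$ Put $\overline\xi(\tau)=\xi(\tau/\gamma_2)$, $K_2=\mathcal K_{\overline\xi}$ and, for $0<\tau\le\gamma_2T$, $$N_2(\tau)=\sqrt\pi\left[\frac1{\sqrt\tau}\int_0^\infty e^{-\frac{(\overline\xi(\tau)-x)^2}{4\tau}}u_0'(x)\,dx-\int_0^\tau\frac{e^{-\frac{(\overline\xi(\tau)-\overline\xi(s))^2}{4(\tau-s)}}}{(\tau-s)^{1/2}}\,\frac{(g_0^+)'(s/\gamma_2)}{\gamma_2}\,ds\right].$$ Then the Volterra equation $$\pi f_2(\tau)=N_2(\tau)+\int_0^\tau K_2(s,\tau)f_2(s)\,ds,\qquad 0<\tau\le\gamma_2T,$$ has exactly one solution $f_2\in C([0,\gamma_2T])$; at $\tau=0$ the equation holds in the limit sense $\pi f_2(0)=\lim_{\tau\to0^+}N_2(\tau)$; and $$u^+_x(\xi(t),t)=f_2(\gamma_2t)\qquad\text{for every } t\in(0,T).$$ **(b) Backward problem.** Let $u_T\in C^1((-\infty,K])$ with $u_T'\in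 L^1((-\infty,K))$, let $g_0^-\in C^1([0,T])$, and let $u^-$ be a regular solution of $$u_t=\gamma_0u_{xx}\ \text{in } V_1,\qquad u(\xi(t),t)=g_0^-(t)\ \text{for } 0<t<T,\qquad u(x,T)=u_T(x)\ \text{for } x<K .$$ Put $\underline\xi(\tau)=K-\xi(T-\tau/|\gamma_0|)$, $K_1=\mathcal K_{\underline\xi}$ and, for $0<\tau\le|\gamma_0|T$, $$N_1(\tau)=\sqrt\pi\left[-\frac1{\sqrt\tau}\int_0^\infty e^{-\frac{(\underline\xi(\tau)-x)^2}{4\tau}}u_T'(K-x)\,dx+\int_0^\tau\frac{e^{-\frac{(\underline\xi(\tau)-\underline\xi(s))^2}{4(\tau-s)}}}{(\tau-s)^{1/2}}\,\frac{(g_0^-)'(T-s/|\gamma_0|)}{|\gamma_0|}\,ds\right].$$ Then the Volterra equation $$\pi f_1(\tau)=N_1(\tau)+\int_0^\tau K_1(s,\tau)f_1(s)\,ds,\qquad 0<\tau\le|\gamma_0|T,$$ has exactly one solution $f_1\in C([0,|\gamma_0|T])$; at $\tau=0$ the equation holds in the limit sense $\pi f_1(0)=\lim_{\tau\to0^+}N_1(\tau)$;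 and $$u^-_x(\xi(t),t)=-f_1(|\gamma_0|(T-t))\qquad\text{for every } t\in(0,T).$$ -/

import Mathlib

open Real Set Filter Topology MeasureTheory

noncomputable section

/-- The partial derivative `u_x`; here `u x t` is a function of space `x` and time `t`. -/
def partialX (u : ℝ → ℝ → ℝ) (x t : ℝ) : ℝ := deriv (fun y => u y t) x

/-- The partial derivative `u_xx`. -/
def partialXX (u : ℝ → ℝ → ℝ) (x t : ℝ) : ℝ := deriv (fun y => partialX u y t) x

/-- The partial derivative `u_t`. -/
def partialT (u : ℝ → ℝ → ℝ) (x t : ℝ) : ℝ := deriv (fun s => u x s) t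

/-- `u ∈ C^{2,1}(V)` for an open set `V` of points `(x, t)`: the derivatives `u_x`, `u_xx`, `u_t`
exist in `V`, and `u`, `u_x`, `u_xx`, `u_t` are continuous there. -/
structure IsC21On (u : ℝ → ℝ → ℝ) (V : Set (ℝ × ℝ)) : Prop where
  diff_x : ∀ p ∈ V, DifferentiableAt ℝ (fun y => u y p.2) p.1
  diff_xx : ∀ p ∈ V, DifferentiableAt ℝ (fun y => partialX u y p.2) p.1
  diff_t : ∀ p ∈ V, DifferentiableAt ℝ (fun s => u p.1 s) p.2
  cont : ContinuousOn (fun p : ℝ × ℝ => u p.1 p.2) V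
  cont_x : ContinuousOn (fun p : ℝ × ℝ => partialX u p.1 p.2) V
  cont_xx : ContinuousOn (fun p : ℝ × ℝ => partialXX u p.1 p.2) V
  cont_t : ContinuousOn (fun p : ℝ × ℝ => partialT u p.1 p.2) V

/-- The region `V₁` to the left of the interface `x = ξ(t)`, `0 < t < T`. -/
def leftRegion (ξ : ℝ → ℝ) (T : ℝ) : Set (ℝ × ℝ) := {p | p.2 ∈ Ioo 0 T ∧ p.1 < ξ p.2}

/-- The region `V₂` to the right of the interface `x = ξ(t)`, `0 < t < T`. -/
def rightRegion (ξ : ℝ → ℝ) (T : ℝ) : Set (ℝ × ℝ) := {p | p.2 ∈ Ioo 0 T ∧ ξ p.2 < p.1}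

/-- Regular solutions in a region `V` of `u_t = γ u_xx`: `u` is bounded, of class `C^{2,1}` in `V`,
continuous up to the boundary, and has a bounded derivative `u_x`. -/
structure IsRegularHeatSolution (γ : ℝ) (V : Set (ℝ × ℝ)) (u : ℝ → ℝ → ℝ) : Prop where
  c21 : IsC21On u V
  cont_closure : ContinuousOn (fun p : ℝ × ℝ => u p.1 p.2) (closure V)
  bounded : ∃ M : ℝ, ∀ p ∈ V, |u p.1 p.2| ≤ M
  bounded_x : ∃ M : ℝ, ∀ p ∈ V, |partialX u p.1 p.2| ≤ M
  eqn : ∀ p ∈ V, partialT u p.1 p.2 = γ * partialXX u p.1 p.2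

/-- `u` is a regular solution of the forward problem: `u_t = γ₂ u_xx` in `V₂`,
`u(ξ(t), t) = g(t)` for `0 < t < T`, `u(x, 0) = u₀(x)` for `x > 0`, and `u_x(·, t)` has a finite
limit at the interface from the right for every `0 < t < T`. -/
structure SolvesForward (γ₂ : ℝ) (ξ : ℝ → ℝ) (T : ℝ) (u₀ g : ℝ → ℝ) (u : ℝ → ℝ → ℝ) : Prop where
  regular : IsRegularHeatSolution γ₂ (rightRegion ξ T) u
  boundary : ∀ t ∈ Ioo 0 T, u (ξ t) t = g t
  initial : ∀ x, 0 < x → u x 0 = u₀ x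
  trace : ∀ t ∈ Ioo 0 T, ∃ l : ℝ, Tendsto (fun η => partialX u (ξ t + η) t) (𝓝[>] 0) (𝓝 l)

/-- `u` is a regular solution of the backward problem: `u_t = γ₀ u_xx` in `V₁`,
`u(ξ(t), t) = g(t)` for `0 < t < T`, `u(x, T) = u_T(x)` for `x < K`, and `u_x(·, t)` has a finite
limit at the interface from the left for every `0 < t < T`. -/
structure SolvesBackward (γ₀ : ℝ) (ξ : ℝ → ℝ) (T K : ℝ) (uT g : ℝ → ℝ) (u : ℝ → ℝ → ℝ) :
    Prop where
  regular : IsRegularHeatSolution γ₀ (leftRegion ξ T) u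
  boundary : ∀ t ∈ Ioo 0 T, u (ξ t) t = g t
  final : ∀ x, x < K → u x T = uT x
  trace : ∀ t ∈ Ioo 0 T, ∃ l : ℝ, Tendsto (fun η => partialX u (ξ t - η) t) (𝓝[>] 0) (𝓝 l)

/-- The heat-type Volterra kernel of a curve `ζ`. -/
def heatKernel (ζ : ℝ → ℝ) (s τ : ℝ) : ℝ :=
  √π / 2 * ((ζ τ - ζ s) / (τ - s)) * (exp (-(ζ τ - ζ s) ^ 2 / (4 * (τ - s))) / √(τ - s))

/-- The rescaled interface `ξ(τ / γ₂)`. -/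
def curve₂ (ξ : ℝ → ℝ) (γ₂ : ℝ) (τ : ℝ) : ℝ := ξ (τ / γ₂)

/-- The reflected and rescaled interface `K - ξ(T - τ / |γ₀|)`. -/
def curve₁ (ξ : ℝ → ℝ) (γ₀ T K : ℝ) (τ : ℝ) : ℝ := K - ξ (T - τ / |γ₀|)

/-- The kernel `K₂`. -/
def kernel₂ (ξ : ℝ → ℝ) (γ₂ : ℝ) : ℝ → ℝ → ℝ := heatKernel (curve₂ ξ γ₂)

/-- The kernel `K₁`. -/
def kernel₁ (ξ : ℝ → ℝ) (γ₀ T K : ℝ) : ℝ → ℝ → ℝ := heatKernel (curve₁ ξ γ₀ T K)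

/-- The data term `N₂`. -/
def datum₂ (ξ : ℝ → ℝ) (γ₂ : ℝ) (u₀ g : ℝ → ℝ) (τ : ℝ) : ℝ :=
  √π * (1 / √τ * (∫ x in Ioi (0 : ℝ), exp (-(curve₂ ξ γ₂ τ - x) ^ 2 / (4 * τ)) * deriv u₀ x)
    - ∫ s in (0 : ℝ)..τ,
        exp (-(curve₂ ξ γ₂ τ - curve₂ ξ γ₂ s) ^ 2 / (4 * (τ - s))) / √(τ - s)
          * (deriv g (s / γ₂) / γ₂))

/-- The data term `N₁`. -/
def datum₁ (ξ : ℝ → ℝ) (γ₀ T K : ℝ) (uT g : ℝ → ℝ) (τ : ℝ) : ℝ :=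
  √π * (-(1 / √τ) *
      (∫ x in Ioi (0 : ℝ), exp (-(curve₁ ξ γ₀ T K τ - x) ^ 2 / (4 * τ)) * deriv uT (K - x))
    + ∫ s in (0 : ℝ)..τ,
        exp (-(curve₁ ξ γ₀ T K τ - curve₁ ξ γ₀ T K s) ^ 2 / (4 * (τ - s))) / √(τ - s)
          * (deriv g (T - s / |γ₀|) / |γ₀|))

/-- `f ∈ C([0, S])` solves `π f(τ) = N(τ) + ∫₀^τ k(s, τ) f(s) ds` for `0 < τ ≤ S`, with a convergent
integral. -/
structure IsVolterraSolution (k : ℝ → ℝ → ℝ) (N : ℝ → ℝ) (S : ℝ) (f : ℝ → ℝ) : Prop where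
  cont : ContinuousOn f (Icc 0 S)
  integrable : ∀ τ ∈ Ioc 0 S, IntervalIntegrable (fun s => k s τ * f s) volume 0 τ
  eqn : ∀ τ ∈ Ioc 0 S, π * f τ = N τ + ∫ s in (0 : ℝ)..τ, k s τ * f s

end

noncomputable section

/-! The flux through the interface is found by a heat potential argument. Scaling time by the
diffusivity and passing to `z = x - ζ(s)` gives a solution of `V_s = V_zz + ζ' V_z` on a fixed
half-line (`SolvesForward.exists_isFlatSolution`). Green's identity up to a time `b < τ`, followed
by integration by parts in `z` and along the boundary, expresses `∫ V_z G` at time `b` through the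
initial slope, the boundary flux `f` paired with `∂ₓG`, and the boundary derivative `h'` paired with
`G` (`IsFlatSolution.green_strip`, `IsFlatSolution.representation`). The test function is `∂ₓG`
acting on `V`, rather than `G` acting on `V_z`: this needs neither third derivatives of the solution
nor boundary values of `u_xx`. Continuity of `u` at the corner cancels the terms coming from there.

As `b → τ` the heat kernel becomes a point mass. With the pole at distance `η` inside the domain
this recovers `2√π V_z(η, τ)`; with the pole outside it gives zero. Adding the two identities for
the poles `ζ(τ) ± η` cancels the opposite jumps of the double layer. The bound
`abs_gaussK₁_add_gaussK₁_le` is uniform in `η`, so `η → 0` is plain dominated convergence and yields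
the integral equation (`IsFlatSolution.flux_eq`).

A priori `f` is only bounded and measurable. The kernel is of order `(τ - s)^(-1/2)`, since the
curve is Lipschitz, and its integral operator maps such functions to continuous ones
(`continuousOn_weaklySingular_integral`). The right-hand side thus supplies a version of `f`
continuous on the closed interval; its value at `0` is the initial slope
(`IsC1Curve.tendsto_integral_initial`). Uniqueness is a Gronwall argument in an exponentially
weighted norm (`eqOn_zero_of_abs_le_weaklySingular_integral`). The backward problem becomes a
forward one under `(x, t) ↦ (K - x, T - t)` (`SolvesBackward.reflect`). -/

/-! ### The heat kernel and its derivatives -/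

/-- The heat kernel without its constant factor, `exp (-x² / (4 r)) / √r`. -/
def gaussK (x r : ℝ) : ℝ := exp (-x ^ 2 / (4 * r)) / √r

/-- The first space derivative of `gaussK`. -/
def gaussK₁ (x r : ℝ) : ℝ := -x / (2 * r) * gaussK x r

/-- The second space derivative of `gaussK`, which is also its time derivative. -/
def gaussK₂ (x r : ℝ) : ℝ := (x ^ 2 / (4 * r ^ 2) - 1 / (2 * r)) * gaussK x r

/-- The third space derivative of `gaussK`. -/
def gaussK₃ (x r : ℝ) : ℝ := (3 * x / (4 * r ^ 2) - x ^ 3 / (8 * r ^ 3)) * gaussK x r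

/-- The kernel solves the heat equation, so `gaussK₂` serves as its time derivative. Both arguments
are allowed to move because along the curve the position and the time lag vary together. -/
theorem hasDerivAt_gaussK_comp {X ρ : ℝ → ℝ} {X' ρ' s : ℝ} (hX : HasDerivAt X X' s)
    (hρ : HasDerivAt ρ ρ' s) (h : 0 < ρ s) :
    HasDerivAt (fun s => gaussK (X s) (ρ s))
      (X' * gaussK₁ (X s) (ρ s) + ρ' * gaussK₂ (X s) (ρ s)) s := by
  have h1 : HasDerivAt (fun s => -X s ^ 2 / (4 * ρ s)) _ s :=
    ((hX.pow 2).neg).div (hρ.const_mul 4) (by positivity)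
  have h2 := (h1.exp).div (hρ.sqrt h.ne') (by positivity)
  refine h2.congr_deriv ?_
  unfold gaussK₁ gaussK₂ gaussK
  have h3 : √(ρ s) ≠ 0 := by positivity
  have h4 : ρ s = √(ρ s) ^ 2 := (sq_sqrt h.le).symm
  generalize √(ρ s) = q at *
  rw [h4]
  simp
  field_simp
  ring

theorem hasDerivAt_gaussK₁_comp {X ρ : ℝ → ℝ} {X' ρ' s : ℝ} (hX : HasDerivAt X X' s)
    (hρ : HasDerivAt ρ ρ' s) (h : 0 < ρ s) :
    HasDerivAt (fun s => gaussK₁ (X s) (ρ s))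
      (X' * gaussK₂ (X s) (ρ s) + ρ' * gaussK₃ (X s) (ρ s)) s := by
  have h1 : HasDerivAt (fun s => -X s / (2 * ρ s)) _ s :=
    (hX.neg).div (hρ.const_mul 2) (by positivity)
  refine (h1.mul (hasDerivAt_gaussK_comp hX hρ h)).congr_deriv ?_
  unfold gaussK₁ gaussK₂ gaussK₃
  generalize gaussK (X s) (ρ s) = q
  simp only [Pi.neg_apply]
  have := h.ne'
  field_simp
  ring

theorem hasDerivAt_gaussK₂_comp {X : ℝ → ℝ} {X' s r : ℝ} (hX : HasDerivAt X X' s) (h : 0 < r) :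
    HasDerivAt (fun s => gaussK₂ (X s) r) (X' * gaussK₃ (X s) r) s := by
  have h1 : HasDerivAt (fun s => X s ^ 2 / (4 * r ^ 2) - 1 / (2 * r)) _ s :=
    ((hX.pow 2).div_const _).sub_const _
  refine (h1.mul (hasDerivAt_gaussK_comp hX (hasDerivAt_const s r) h)).congr_deriv ?_
  unfold gaussK₁ gaussK₂ gaussK₃
  simp
  generalize gaussK (X s) r = q
  have := h.ne'
  field_simp
  ring

theorem gaussK_nonneg (x r : ℝ) : 0 ≤ gaussK x r := by unfold gaussK; positivity

theorem gaussK_le {x r : ℝ} : gaussK x r ≤ 1 / √r := by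
  unfold gaussK
  rcases le_or_gt r 0 with h | h
  -- For `r ≤ 0` the square root is zero and both quotients vanish by convention, so no sign
  -- condition on `r` is needed.
  · simp [sqrt_eq_zero_of_nonpos h]
  · gcongr
    rw [exp_le_one_iff]
    have : 0 ≤ x ^ 2 / (4 * r) := by positivity
    rw [neg_div]; linarith

theorem continuousOn_gaussK {α : Type*} [TopologicalSpace α] {X ρ : α → ℝ} {A : Set α}
    (hX : ContinuousOn X A) (hρ : ContinuousOn ρ A) (h : ∀ a ∈ A, 0 < ρ a) :
    ContinuousOn (fun a => gaussK (X a) (ρ a)) A := by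
  unfold gaussK
  refine ContinuousOn.div (ContinuousOn.rexp (ContinuousOn.div (by fun_prop) (by fun_prop) ?_))
    (hρ.sqrt) ?_
  · intro a ha; have := h a ha; positivity
  · intro a ha; have := h a ha; positivity

theorem continuousOn_gaussK₁ {α : Type*} [TopologicalSpace α] {X ρ : α → ℝ} {A : Set α}
    (hX : ContinuousOn X A) (hρ : ContinuousOn ρ A) (h : ∀ a ∈ A, 0 < ρ a) :
    ContinuousOn (fun a => gaussK₁ (X a) (ρ a)) A := by
  unfold gaussK₁
  refine ContinuousOn.mul (ContinuousOn.div (by fun_prop) (by fun_prop) ?_)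
    (continuousOn_gaussK hX hρ h)
  intro a ha; have := h a ha; positivity

theorem continuousOn_gaussK₂ {α : Type*} [TopologicalSpace α] {X ρ : α → ℝ} {A : Set α}
    (hX : ContinuousOn X A) (hρ : ContinuousOn ρ A) (h : ∀ a ∈ A, 0 < ρ a) :
    ContinuousOn (fun a => gaussK₂ (X a) (ρ a)) A := by
  unfold gaussK₂
  refine ContinuousOn.mul (ContinuousOn.sub (ContinuousOn.div (by fun_prop) (by fun_prop) ?_)
    (ContinuousOn.div (by fun_prop) (by fun_prop) ?_)) (continuousOn_gaussK hX hρ h)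
  all_goals intro a ha; have := h a ha; positivity

theorem continuousOn_gaussK₃ {α : Type*} [TopologicalSpace α] {X ρ : α → ℝ} {A : Set α}
    (hX : ContinuousOn X A) (hρ : ContinuousOn ρ A) (h : ∀ a ∈ A, 0 < ρ a) :
    ContinuousOn (fun a => gaussK₃ (X a) (ρ a)) A := by
  unfold gaussK₃
  refine ContinuousOn.mul (ContinuousOn.sub (ContinuousOn.div (by fun_prop) (by fun_prop) ?_)
    (ContinuousOn.div (by fun_prop) (by fun_prop) ?_)) (continuousOn_gaussK hX hρ h)
  all_goals intro a ha; have := h a ha; positivity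

/-! ### Gaussian bounds -/

/-- Half of the Gaussian exponent is spent on absorbing the polynomial factor. -/
theorem mul_exp_neg_sq_le (q : ℝ) : q * exp (-q ^ 2) ≤ exp (-(q ^ 2 / 2)) := by
  have h1 : q ≤ exp (q ^ 2 / 2) := by
    have := add_one_le_exp (q ^ 2 / 2)
    nlinarith [sq_nonneg (q - 1)]
  calc q * exp (-q ^ 2) ≤ exp (q ^ 2 / 2) * exp (-q ^ 2) := by gcongr
    _ = exp (-(q ^ 2 / 2)) := by rw [← exp_add]; ring_nf

theorem sq_add_half_mul_exp_neg_sq_le (q : ℝ) :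
    (q ^ 2 + 1 / 2) * exp (-q ^ 2) ≤ 2 * exp (-(q ^ 2 / 2)) := by
  have h1 : q ^ 2 + 1 / 2 ≤ 2 * exp (q ^ 2 / 2) := by
    have := add_one_le_exp (q ^ 2 / 2)
    linarith
  calc (q ^ 2 + 1 / 2) * exp (-q ^ 2) ≤ 2 * exp (q ^ 2 / 2) * exp (-q ^ 2) := by gcongr
    _ = 2 * exp (-(q ^ 2 / 2)) := by rw [mul_assoc, ← exp_add]; ring_nf

/-- With `q = |x| / (2√r)` the left side equals `(1 / r) q exp(-q²)`. -/
theorem abs_gaussK₁_le {r : ℝ} (hr : 0 < r) (x : ℝ) :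
    |gaussK₁ x r| ≤ 1 / r * exp (-(x ^ 2 / (8 * r))) := by
  have hq : 0 < √r := by positivity
  have h4 : r = √r ^ 2 := (sq_sqrt hr.le).symm
  have h := mul_exp_neg_sq_le (|x| / (2 * √r))
  have e1 : (|x| / (2 * √r)) ^ 2 = x ^ 2 / (4 * r) := by
    rw [div_pow, sq_abs, mul_pow, ← h4]; norm_num
  rw [e1] at h
  have e2 : x ^ 2 / (4 * r) / 2 = x ^ 2 / (8 * r) := by field_simp; ring
  rw [e2] at h
  unfold gaussK₁ gaussK
  rw [abs_mul, abs_div, abs_neg, abs_of_pos (show 0 < 2 * r by positivity),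
    abs_of_nonneg (show 0 ≤ exp (-x ^ 2 / (4 * r)) / √r by positivity)]
  calc |x| / (2 * r) * (exp (-x ^ 2 / (4 * r)) / √r)
      = 1 / r * (|x| / (2 * √r) * exp (-(x ^ 2 / (4 * r)))) := by rw [neg_div]; field_simp
    _ ≤ _ := by gcongr

theorem abs_gaussK₂_le {r : ℝ} (hr : 0 < r) (x : ℝ) :
    |gaussK₂ x r| ≤ 2 / (r * √r) * exp (-(x ^ 2 / (8 * r))) := by
  have hq : 0 < √r := by positivity
  have h4 : r = √r ^ 2 := (sq_sqrt hr.le).symm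
  have h := sq_add_half_mul_exp_neg_sq_le (|x| / (2 * √r))
  have e1 : (|x| / (2 * √r)) ^ 2 = x ^ 2 / (4 * r) := by
    rw [div_pow, sq_abs, mul_pow, ← h4]; norm_num
  rw [e1] at h
  have e2 : x ^ 2 / (4 * r) / 2 = x ^ 2 / (8 * r) := by field_simp; ring
  rw [e2] at h
  unfold gaussK₂ gaussK
  rw [abs_mul, abs_of_nonneg (show 0 ≤ exp (-x ^ 2 / (4 * r)) / √r by positivity)]
  have h5 : |x ^ 2 / (4 * r ^ 2) - 1 / (2 * r)| ≤ (x ^ 2 / (4 * r) + 1 / 2) / r := by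
    have e : x ^ 2 / (4 * r ^ 2) - 1 / (2 * r) = (x ^ 2 / (4 * r) - 1 / 2) / r := by
      field_simp
    rw [e, abs_div, abs_of_pos hr]
    have : 0 ≤ x ^ 2 / (4 * r) := by positivity
    gcongr
    rw [abs_le]; constructor <;> linarith
  calc |x ^ 2 / (4 * r ^ 2) - 1 / (2 * r)| * (exp (-x ^ 2 / (4 * r)) / √r)
      ≤ (x ^ 2 / (4 * r) + 1 / 2) / r * (exp (-x ^ 2 / (4 * r)) / √r) := by gcongr
    _ = 1 / (r * √r) * ((x ^ 2 / (4 * r) + 1 / 2) * exp (-(x ^ 2 / (4 * r)))) := by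
        rw [neg_div]; field_simp
    _ ≤ 1 / (r * √r) * (2 * exp (-(x ^ 2 / (8 * r)))) := by gcongr
    _ = _ := by ring

/-- The inequality `(c - z)² ≥ z² / 2 - c²`, which is `(2c - z)² ≥ 0`, replaces a moving centre by a
fixed one at the cost of half the exponent. -/
theorem exp_neg_sq_sub_le {c z r r₀ r₁ m : ℝ} (hr₀ : 0 < r₀) (h₀ : r₀ ≤ r) (h₁ : r ≤ r₁)
    (hc : |c| ≤ m) :
    exp (-((c - z) ^ 2 / (8 * r))) ≤ exp (m ^ 2 / (8 * r₀)) * exp (-(1 / (16 * r₁)) * z ^ 2) := by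
  have hr : 0 < r := hr₀.trans_le h₀
  rw [← exp_add, exp_le_exp]
  have hc2 : c ^ 2 ≤ m ^ 2 := sq_le_sq' (by linarith [(abs_le.1 hc).1]) (abs_le.1 hc).2
  have h2 : c ^ 2 / (8 * r) ≤ m ^ 2 / (8 * r₀) := by gcongr
  have h3 : z ^ 2 / (16 * r₁) ≤ z ^ 2 / (16 * r) := by gcongr
  have h4 : z ^ 2 / (16 * r) - c ^ 2 / (8 * r) ≤ (c - z) ^ 2 / (8 * r) := by
    rw [show z ^ 2 / (16 * r) - c ^ 2 / (8 * r) = (z ^ 2 / 2 - c ^ 2) / (8 * r) by field_simp; ring]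
    gcongr
    nlinarith [sq_nonneg (2 * c - z)]
  have : -(1 / (16 * r₁)) * z ^ 2 = - (z ^ 2 / (16 * r₁)) := by ring
  rw [this]; linarith

/-- A common Gaussian majorant of the kernel and its first two derivatives. -/
theorem exists_gaussian_majorant {r₀ : ℝ} (r₁ m : ℝ) (hr₀ : 0 < r₀) (h01 : r₀ ≤ r₁) :
    ∃ C k : ℝ, 0 ≤ C ∧ 0 < k ∧ ∀ c r z, r₀ ≤ r → r ≤ r₁ → |c| ≤ m →
      |gaussK (c - z) r| ≤ C * exp (-k * z ^ 2) ∧ |gaussK₁ (c - z) r| ≤ C * exp (-k * z ^ 2) ∧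
      |gaussK₂ (c - z) r| ≤ C * exp (-k * z ^ 2) := by
  have hr₁ : 0 < r₁ := hr₀.trans_le h01
  -- The sum of the three prefactors at the smallest time lag dominates each of them at every `r ≥
  -- r₀`.
  set A := 1 / √r₀ + 1 / r₀ + 2 / (r₀ * √r₀) with hA
  have p1 : 0 < 1 / √r₀ := by positivity
  have p2 : 0 < 1 / r₀ := by positivity
  have p3 : 0 < 2 / (r₀ * √r₀) := by positivity
  refine ⟨A * exp (m ^ 2 / (8 * r₀)), 1 / (16 * r₁), by positivity, by positivity, ?_⟩
  intro c r z h0 h1 hc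
  have hr : 0 < r := hr₀.trans_le h0
  have hE := exp_neg_sq_sub_le (z := z) hr₀ h0 h1 hc
  have hs : √r₀ ≤ √r := sqrt_le_sqrt h0
  have key : ∀ a b : ℝ, a ≤ b * exp (-((c - z) ^ 2 / (8 * r))) → 0 ≤ b → b ≤ A →
      a ≤ A * exp (m ^ 2 / (8 * r₀)) * exp (-(1 / (16 * r₁)) * z ^ 2) := by
    intro a b h1 h2 h3
    calc a ≤ b * exp (-((c - z) ^ 2 / (8 * r))) := h1
      _ ≤ A * (exp (m ^ 2 / (8 * r₀)) * exp (-(1 / (16 * r₁)) * z ^ 2)) := by gcongr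
      _ = _ := by ring
  refine ⟨key _ (1 / √r) ?_ (by positivity) ?_, key _ _ (abs_gaussK₁_le hr _) (by positivity) ?_,
    key _ _ (abs_gaussK₂_le hr _) (by positivity) ?_⟩
  · rw [abs_of_nonneg (gaussK_nonneg _ _), gaussK, div_eq_mul_inv, mul_comm, one_div]
    have : 0 ≤ (c - z) ^ 2 / (8 * r) := by positivity
    have e : (c - z) ^ 2 / (4 * r) = 2 * ((c - z) ^ 2 / (8 * r)) := by field_simp; ring
    gcongr
    rw [neg_div, e]; linarith
  · have : 1 / √r ≤ 1 / √r₀ := by gcongr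
    linarith
  · have : 1 / r ≤ 1 / r₀ := by gcongr
    linarith
  · have : 2 / (r * √r) ≤ 2 / (r₀ * √r₀) := by gcongr
    linarith

/-! ### Weakly singular Volterra integrals -/

theorem one_div_sqrt_eq_rpow {x : ℝ} (hx : 0 ≤ x) : 1 / √x = x ^ (-(1 / 2) : ℝ) := by
  rw [rpow_neg hx, sqrt_eq_rpow, one_div]

theorem intervalIntegrable_one_div_sqrt_sub {a b : ℝ} (hab : a ≤ b) :
    IntervalIntegrable (fun s => 1 / √(b - s)) volume a b := by
  have h : IntervalIntegrable (fun x : ℝ => 1 / √x) volume (b - a) (b - b) := by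
    have h0 : IntervalIntegrable (fun x : ℝ => x ^ (-(1 / 2) : ℝ)) volume (b - a) (b - b) :=
      intervalIntegral.intervalIntegrable_rpow' (by norm_num)
    refine h0.congr fun x hx => ?_
    rw [uIoc_of_ge (by linarith)] at hx
    exact (one_div_sqrt_eq_rpow (by linarith [hx.1])).symm
  simpa using h.comp_sub_left b

theorem integral_one_div_sqrt_sub {a b : ℝ} (hab : a ≤ b) :
    ∫ s in a..b, 1 / √(b - s) = 2 * √(b - a) := by
  rw [intervalIntegral.integral_comp_sub_left (fun x => 1 / √x) b, sub_self]
  have : ∫ x in (0 : ℝ)..(b - a), 1 / √x = ∫ x in (0 : ℝ)..(b - a), x ^ (-(1 / 2) : ℝ) := by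
    refine intervalIntegral.integral_congr fun x hx => ?_
    rw [uIcc_of_le (by linarith)] at hx
    exact one_div_sqrt_eq_rpow hx.1
  rw [this, integral_rpow (Or.inl (by norm_num)), sqrt_eq_rpow,
    zero_rpow (by norm_num)]
  norm_num
  ring

theorem intervalIntegrable_of_abs_le_div_sqrt {q : ℝ → ℝ} {τ C : ℝ} (hτ : 0 ≤ τ)
    (hm : AEStronglyMeasurable q (volume.restrict (Ioo 0 τ)))
    (hb : ∀ s ∈ Ioo 0 τ, |q s| ≤ C / √(τ - s)) : IntervalIntegrable q volume 0 τ := by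
  rw [intervalIntegrable_iff_integrableOn_Ioo_of_le hτ]
  have h1 := ((intervalIntegrable_iff_integrableOn_Ioo_of_le hτ).1
    (intervalIntegrable_one_div_sqrt_sub hτ)).const_mul C
  refine h1.mono' hm ?_
  refine (ae_restrict_mem measurableSet_Ioo).mono fun s hs => ?_
  rw [norm_eq_abs, mul_one_div]
  exact hb s hs

/-- An integral operator of Volterra type with a kernel of order `(τ - s)^{-1/2}` has continuous
values. -/
theorem continuousOn_weaklySingular_integral {q : ℝ → ℝ → ℝ} {S C : ℝ} (hC : 0 ≤ C)
    (hm : ∀ τ ∈ Icc 0 S, AEStronglyMeasurable (fun s => q s τ) (volume.restrict (Ioo 0 τ)))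
    (hb : ∀ τ ∈ Icc 0 S, ∀ s ∈ Ioo 0 τ, |q s τ| ≤ C / √(τ - s))
    (hc : ∀ τ ∈ Icc 0 S, ∀ s ∈ Ioo 0 τ, ContinuousWithinAt (fun τ => q s τ) (Icc 0 S) τ) :
    ContinuousOn (fun τ => ∫ s in (0 : ℝ)..τ, q s τ) (Icc 0 S) := by
  have hqi : ∀ τ ∈ Icc 0 S, IntervalIntegrable (fun s => q s τ) volume 0 τ := fun τ hτ =>
    intervalIntegrable_of_abs_le_div_sqrt hτ.1 (hm τ hτ) (hb τ hτ)
  -- The last stretch of length `δ` is cut off, which costs at most `2C√δ` uniformly in `τ`. What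
  -- remains has a bounded integrand. Writing it with an indicator over the fixed interval `(0, S)`
  -- makes dominated convergence in `τ` applicable.
  let F : ℝ → ℝ → ℝ := fun δ τ =>
    ∫ s in Ioo 0 S, (Ioo 0 (τ - δ)).indicator (fun s => q s τ) s
  have hF : TendstoUniformlyOn F (fun τ => ∫ s in (0 : ℝ)..τ, q s τ) (𝓝[>] 0) (Icc 0 S) := by
    rw [Metric.tendstoUniformlyOn_iff]
    intro ε hε
    have hlim : Tendsto (fun δ : ℝ => C * (2 * √δ)) (𝓝[>] 0) (𝓝 0) := by
      have : Tendsto (fun δ : ℝ => C * (2 * √δ)) (𝓝 0) (𝓝 (C * (2 * √0))) :=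
        (by fun_prop : Continuous fun δ : ℝ => C * (2 * √δ)).tendsto 0
      simp only [sqrt_zero, mul_zero] at this
      exact this.mono_left nhdsWithin_le_nhds
    filter_upwards [hlim.eventually_lt_const hε, self_mem_nhdsWithin] with δ hδ hδ0 τ hτ
    have hδ0 : 0 < δ := hδ0
    refine lt_of_le_of_lt ?_ hδ
    -- For `τ < δ` the truncated interval is empty, and the cut starts at `0`.
    set a := max (τ - δ) 0 with ha
    have ha0 : 0 ≤ a := le_max_right _ _
    have haτ : a ≤ τ := max_le (by linarith) hτ.1
    have e1 : F δ τ = ∫ s in (0 : ℝ)..a, q s τ := by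
      rw [intervalIntegral.integral_of_le ha0, integral_Ioc_eq_integral_Ioo]
      simp only [F]
      rw [setIntegral_indicator measurableSet_Ioo]
      congr 2
      ext s
      simp only [mem_inter_iff, mem_Ioo, ha, lt_max_iff]
      constructor
      · rintro ⟨h1, h2⟩; exact ⟨h1.1, Or.inl h2.2⟩
      · rintro ⟨h1, h2⟩
        have : s < τ - δ := by rcases h2 with h | h <;> linarith
        exact ⟨⟨h1, by linarith [hτ.2]⟩, h1, this⟩
    have hsub1 : IntervalIntegrable (fun s => q s τ) volume 0 a :=
      (hqi τ hτ).mono_set (by rw [uIcc_of_le ha0, uIcc_of_le hτ.1]; exact Icc_subset_Icc_right haτ)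
    have hsub2 : IntervalIntegrable (fun s => q s τ) volume a τ :=
      (hqi τ hτ).mono_set (by rw [uIcc_of_le haτ, uIcc_of_le hτ.1]; exact Icc_subset_Icc_left ha0)
    rw [e1, dist_eq_norm, ← intervalIntegral.integral_add_adjacent_intervals hsub1 hsub2,
      add_sub_cancel_left]
    calc ‖∫ s in a..τ, q s τ‖ ≤ ∫ s in a..τ, C * (1 / √(τ - s)) := by
          refine intervalIntegral.norm_integral_le_of_norm_le haτ ?_
            ((intervalIntegrable_one_div_sqrt_sub haτ).const_mul C)
          have : ∀ᵐ s : ℝ ∂volume, s ≠ τ := by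
            simp [ae_iff]
          filter_upwards [this] with s hsτ hs
          rw [norm_eq_abs, mul_one_div]
          exact hb τ hτ s ⟨ha0.trans_lt hs.1, lt_of_le_of_ne hs.2 hsτ⟩
      _ = C * (2 * √(τ - a)) := by
          rw [intervalIntegral.integral_const_mul, integral_one_div_sqrt_sub haτ]
      _ ≤ C * (2 * √δ) := by
          gcongr
          linarith [le_max_left (τ - δ) 0]
  refine hF.continuousOn (Eventually.frequently ?_)
  filter_upwards [self_mem_nhdsWithin] with δ hδ
  have hδ : 0 < δ := hδ
  intro τ₀ hτ₀
  refine continuousWithinAt_of_dominated (bound := fun _ => C / √δ) ?_ ?_ ?_ ?_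
  · filter_upwards [self_mem_nhdsWithin] with τ hτ
    rw [aestronglyMeasurable_indicator_iff measurableSet_Ioo, Measure.restrict_restrict
      measurableSet_Ioo]
    refine (hm τ hτ).mono_measure (Measure.restrict_mono ?_ le_rfl)
    exact fun s hs => ⟨hs.1.1, by linarith [hs.1.2]⟩
  · filter_upwards [self_mem_nhdsWithin] with τ hτ
    refine Eventually.of_forall fun s => ?_
    by_cases hs : s ∈ Ioo 0 (τ - δ)
    · rw [indicator_of_mem hs, norm_eq_abs]
      refine (hb τ hτ s ⟨hs.1, by linarith [hs.2]⟩).trans ?_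
      have : δ ≤ τ - s := by linarith [hs.2]
      gcongr
    · rw [indicator_of_notMem hs]; simp; positivity
  · exact integrable_const _
  -- The indicator may jump in `τ` only when `s` is the endpoint of the cut, a single point that can
  -- be discarded.
  · have : ∀ᵐ s : ℝ ∂volume.restrict (Ioo 0 S), s ≠ τ₀ - δ :=
      ae_restrict_of_ae (by simp [ae_iff])
    filter_upwards [this, ae_restrict_mem measurableSet_Ioo] with s hs hsS
    rcases lt_or_gt_of_ne hs with h | h
    · have h1 := hc τ₀ hτ₀ s ⟨hsS.1, by linarith⟩
      refine h1.congr_of_eventuallyEq ?_ ?_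
      · have : ∀ᶠ τ in 𝓝 τ₀, s + δ < τ := eventually_gt_nhds (by linarith)
        filter_upwards [nhdsWithin_le_nhds this] with τ hτ
        exact indicator_of_mem (show s ∈ Ioo 0 (τ - δ) from ⟨hsS.1, by linarith⟩) _
      · exact indicator_of_mem (show s ∈ Ioo 0 (τ₀ - δ) from ⟨hsS.1, by linarith⟩) _
    · refine ContinuousWithinAt.congr_of_eventuallyEq (f := fun _ => (0 : ℝ))
        continuousWithinAt_const ?_ ?_
      · have : ∀ᶠ τ in 𝓝 τ₀, τ < s + δ := eventually_lt_nhds (by linarith)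
        filter_upwards [nhdsWithin_le_nhds this] with τ hτ
        exact indicator_of_notMem (fun hh : s ∈ Ioo 0 (τ - δ) => by linarith [hh.2]) _
      · exact indicator_of_notMem (fun hh : s ∈ Ioo 0 (τ₀ - δ) => by linarith [hh.2]) _

/-- The substitution `r = τ - s` leaves an incomplete Gamma integral, bounded by the full one with
`Γ(1/2) = √π`. The gain `√(π / l)`, small for large `l`, drives the Gronwall argument. -/
theorem integral_exp_mul_one_div_sqrt_sub_le {l τ : ℝ} (hl : 0 < l) (hτ : 0 ≤ τ) :
    ∫ s in (0 : ℝ)..τ, 1 / √(τ - s) * exp (l * s) ≤ exp (l * τ) * √(π / l) := by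
  have e1 : ∀ s, 1 / √(τ - s) * exp (l * s)
      = (fun r => exp (l * τ) * (1 / √r * exp (-(l * r)))) (τ - s) := by
    intro s
    simp only
    rw [mul_left_comm, ← exp_add]; ring_nf
  simp_rw [e1]
  rw [intervalIntegral.integral_comp_sub_left (fun r => exp (l * τ) * (1 / √r * exp (-(l * r)))) τ,
    sub_self, sub_zero, intervalIntegral.integral_const_mul]
  have hG := integral_rpow_mul_exp_neg_mul_Ioi (a := 1 / 2) (r := l) (by norm_num) hl
  have hGi : IntegrableOn (fun t : ℝ => t ^ (1 / 2 - 1 : ℝ) * exp (-(l * t))) (Ioi 0) := by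
    -- A non-integrable function would have integral zero by convention, whereas the Gamma formula
    -- gives a positive value.
    by_contra hni
    rw [integral_undef hni, Real.Gamma_one_half_eq] at hG
    have : 0 < (1 / l) ^ (1 / 2 : ℝ) * √π := by positivity
    linarith
  have hcongr : ∀ t ∈ Ioc 0 τ, 1 / √t * exp (-(l * t))
      = t ^ (1 / 2 - 1 : ℝ) * exp (-(l * t)) := by
    intro t ht
    rw [one_div_sqrt_eq_rpow ht.1.le]; norm_num
  gcongr
  rw [intervalIntegral.integral_of_le hτ, setIntegral_congr_fun measurableSet_Ioc hcongr]
  refine (setIntegral_mono_set hGi ?_ (Ioc_subset_Ioi_self).eventuallyLE).trans ?_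
  · refine (ae_restrict_mem measurableSet_Ioi).mono fun t ht => ?_
    have : 0 < t := ht
    simp only [Pi.zero_apply]; positivity
  · rw [hG, Real.Gamma_one_half_eq, ← sqrt_eq_rpow, ← sqrt_mul (by positivity)]
    apply le_of_eq; congr 1; ring

/-- A Gronwall-type lemma for a kernel with an inverse square root singularity. -/
theorem eqOn_zero_of_abs_le_weaklySingular_integral {d : ℝ → ℝ} {S C : ℝ} (hC : 0 ≤ C)
    (hd : ContinuousOn d (Icc 0 S))
    (h : ∀ τ ∈ Icc 0 S, |d τ| ≤ C * ∫ s in (0 : ℝ)..τ, 1 / √(τ - s) * |d s|) :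
    EqOn d 0 (Icc 0 S) := by
  intro τ₀ hτ₀
  have hS : (0 : ℝ) ≤ S := hτ₀.1.trans hτ₀.2
  -- Chosen so that `C √(π / l) = C / (2C + 1)` stays below one half. At a maximum of the weighted
  -- function the hypothesis then gives `m ≤ m / 2`.
  set l : ℝ := π * (2 * C + 1) ^ 2 with hl
  have hl0 : 0 < l := by positivity
  have hsq : C * √(π / l) ≤ 1 / 2 := by
    have : π / l = (1 / (2 * C + 1)) ^ 2 := by
      rw [hl]; field_simp
    rw [this, sqrt_sq (by positivity), mul_one_div, div_le_iff₀ (by positivity)]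
    linarith
  obtain ⟨τ, hτ, hmax⟩ := isCompact_Icc.exists_isMaxOn (nonempty_Icc.2 hS)
    (show ContinuousOn (fun s => |d s| * exp (-(l * s))) (Icc 0 S) by fun_prop)
  set m := |d τ| * exp (-(l * τ)) with hm
  have hm0 : 0 ≤ m := by positivity
  have hle : ∀ s ∈ Icc 0 S, |d s| ≤ m * exp (l * s) := by
    intro s hs
    have h1 : |d s| * exp (-(l * s)) ≤ m := hmax hs
    calc |d s| = |d s| * exp (-(l * s)) * exp (l * s) := by
          rw [mul_assoc, ← exp_add]; simp
      _ ≤ _ := by gcongr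
  have hi := intervalIntegrable_one_div_sqrt_sub hτ.1
  have hsub : uIcc 0 τ ⊆ Icc 0 S := by
    rw [uIcc_of_le hτ.1]; exact Icc_subset_Icc_right hτ.2
  have h2 : ∫ s in (0 : ℝ)..τ, 1 / √(τ - s) * |d s| ≤ m * (exp (l * τ) * √(π / l)) := by
    refine le_trans ?_ (mul_le_mul_of_nonneg_left
      (integral_exp_mul_one_div_sqrt_sub_le hl0 hτ.1) hm0)
    rw [← intervalIntegral.integral_const_mul]
    refine intervalIntegral.integral_mono_on hτ.1 ?_ ?_ ?_
    · exact hi.mul_continuousOn ((hd.mono hsub).abs)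
    · exact (hi.mul_continuousOn (by fun_prop)).const_mul m
    · intro s hs
      have := hle s ⟨hs.1, hs.2.trans hτ.2⟩
      calc 1 / √(τ - s) * |d s| ≤ 1 / √(τ - s) * (m * exp (l * s)) := by gcongr
        _ = _ := by ring
  have h3 : m ≤ m * (1 / 2) := by
    calc m ≤ (C * (m * (exp (l * τ) * √(π / l)))) * exp (-(l * τ)) := by
          rw [hm]; gcongr; exact (h τ hτ).trans (by gcongr)
      _ = m * (C * √(π / l)) * (exp (l * τ) * exp (-(l * τ))) := by ring
      _ = m * (C * √(π / l)) := by rw [← exp_add]; simp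
      _ ≤ _ := by gcongr
  have h4 : m = 0 := by linarith
  have := hle τ₀ hτ₀
  rw [h4, zero_mul] at this
  simpa using this

/-! ### Straightened solutions and Green's identity -/

/-- `φ` is continuous on `[0, S]` and has a continuous derivative in `(0, S)` bounded by `L`. -/
structure IsC1Curve (S : ℝ) (φ : ℝ → ℝ) (L : ℝ) : Prop where
  cont : ContinuousOn φ (Icc 0 S)
  diff : ∀ s ∈ Ioo 0 S, DifferentiableAt ℝ φ s
  cont_deriv : ContinuousOn (deriv φ) (Ioo 0 S)
  bound : ∀ s ∈ Ioo 0 S, |deriv φ s| ≤ L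

theorem IsC1Curve.abs_sub_le {S L : ℝ} {φ : ℝ → ℝ} (h : IsC1Curve S φ L) {a b : ℝ}
    (ha : 0 ≤ a) (hab : a < b) (hb : b ≤ S) : |φ b - φ a| ≤ L * (b - a) := by
  obtain ⟨c, hc, hc'⟩ := exists_deriv_eq_slope φ hab (h.cont.mono (Icc_subset_Icc ha hb))
    (fun x hx => (h.diff x ⟨ha.trans_lt hx.1, hx.2.trans_le hb⟩).differentiableWithinAt)
  have h1 := h.bound c ⟨ha.trans_lt hc.1, hc.2.trans_le hb⟩
  have hba : 0 < b - a := by linarith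
  rw [hc', abs_div, abs_of_pos hba, div_le_iff₀ hba] at h1
  exact h1

theorem IsC1Curve.nonneg {S L : ℝ} {φ : ℝ → ℝ} (h : IsC1Curve S φ L) (hS : 0 < S) : 0 ≤ L :=
  (abs_nonneg _).trans (h.bound (S / 2) ⟨by linarith, by linarith⟩)

/-- A solution `V(z, s)` of `V_s = V_zz + ζ'(s) V_z` for `z > 0`, `0 < s < S`, with `W = V_z`,
`Q = V_zz`, boundary values `h`, initial values `v₀` and boundary flux `f`; this is the heat
equation to the right of the curve `ζ` in the coordinate `z = x - ζ(s)`. -/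
structure IsFlatSolution (S : ℝ) (ζ h v₀ : ℝ → ℝ) (V W Q : ℝ → ℝ → ℝ) (f : ℝ → ℝ) (M : ℝ) :
    Prop where
  hasDerivAt_z : ∀ z s, 0 < z → s ∈ Ioo 0 S → HasDerivAt (fun y => V y s) (W z s) z
  hasDerivAt_zz : ∀ z s, 0 < z → s ∈ Ioo 0 S → HasDerivAt (fun y => W y s) (Q z s) z
  hasDerivAt_s : ∀ z s, 0 < z → s ∈ Ioo 0 S →
    HasDerivAt (fun s => V z s) (Q z s + deriv ζ s * W z s) s
  cont : ContinuousOn (fun p : ℝ × ℝ => V p.1 p.2) (Ioi 0 ×ˢ Ioo 0 S)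
  cont_z : ContinuousOn (fun p : ℝ × ℝ => W p.1 p.2) (Ioi 0 ×ˢ Ioo 0 S)
  cont_zz : ContinuousOn (fun p : ℝ × ℝ => Q p.1 p.2) (Ioi 0 ×ˢ Ioo 0 S)
  bound : ∀ z s, 0 < z → s ∈ Ioo 0 S → |V z s| ≤ M
  bound_z : ∀ z s, 0 < z → s ∈ Ioo 0 S → |W z s| ≤ M
  boundary : ∀ s ∈ Ioo 0 S, Tendsto (fun z => V z s) (𝓝[>] 0) (𝓝 (h s))
  flux : ∀ s ∈ Ioo 0 S, Tendsto (fun z => W z s) (𝓝[>] 0) (𝓝 (f s))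
  initial : ∀ z, 0 < z → Tendsto (fun s => V z s) (𝓝[>] 0) (𝓝 (v₀ z))

/-- Since `A_s = D = B_z`, both sides are iterated integrals of `D` over the rectangle in opposite
orders. -/
theorem integral_sub_eq_integral_sub_of_hasDerivAt {A B D : ℝ → ℝ → ℝ} {e R a b : ℝ} (heR : e ≤ R)
    (hab : a ≤ b) (hA : ∀ z ∈ Icc e R, ∀ s ∈ Icc a b, HasDerivAt (fun s => A z s) (D z s) s)
    (hB : ∀ z ∈ Icc e R, ∀ s ∈ Icc a b, HasDerivAt (fun z => B z s) (D z s) z)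
    (hD : ContinuousOn (fun p : ℝ × ℝ => D p.1 p.2) (Icc e R ×ˢ Icc a b)) :
    ∫ z in e..R, (A z b - A z a) = ∫ s in a..b, (B R s - B e s) := by
  have h1 : ∀ z ∈ uIcc e R, A z b - A z a = ∫ s in a..b, D z s := by
    intro z hz
    rw [uIcc_of_le heR] at hz
    symm
    refine intervalIntegral.integral_eq_sub_of_hasDerivAt ?_ ?_
    · intro s hs; rw [uIcc_of_le hab] at hs; exact hA z hz s hs
    · refine ContinuousOn.intervalIntegrable ?_
      rw [uIcc_of_le hab]
      exact hD.comp (f := fun s => (z, s)) (by fun_prop) fun s hs => ⟨hz, hs⟩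
  have h2 : ∀ s ∈ uIcc a b, B R s - B e s = ∫ z in e..R, D z s := by
    intro s hs
    rw [uIcc_of_le hab] at hs
    symm
    refine intervalIntegral.integral_eq_sub_of_hasDerivAt (f := fun z => B z s) ?_ ?_
    · intro z hz; rw [uIcc_of_le heR] at hz; exact hB z hz s hs
    · refine ContinuousOn.intervalIntegrable ?_
      rw [uIcc_of_le heR]
      exact hD.comp (f := fun z => (z, s)) (by fun_prop) fun z hz => ⟨hz, hs⟩
  rw [intervalIntegral.integral_congr h1, intervalIntegral.integral_congr h2]
  refine intervalIntegral_intervalIntegral_swap ?_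
  rw [uIoc_of_le heR, uIoc_of_le hab]
  have h3 : IntegrableOn (fun p : ℝ × ℝ => D p.1 p.2) (Icc e R ×ˢ Icc a b)
      volume :=
    hD.integrableOn_compact (isCompact_Icc.prod isCompact_Icc)
  exact h3.mono_set (prod_mono Ioc_subset_Icc_self Ioc_subset_Icc_self)

section

variable {S L M : ℝ} {ζ h v₀ f : ℝ → ℝ} {V W Q : ℝ → ℝ → ℝ}

theorem IsFlatSolution.continuousOn_slice_z (H : IsFlatSolution S ζ h v₀ V W Q f M) {s : ℝ}
    (hs : s ∈ Ioo 0 S) :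
    ContinuousOn (fun z => V z s) (Ioi 0) ∧ ContinuousOn (fun z => W z s) (Ioi 0) :=
  ⟨H.cont.comp (f := fun z => (z, s)) (by fun_prop) fun _ hz => ⟨hz, hs⟩,
    H.cont_z.comp (f := fun z => (z, s)) (by fun_prop) fun _ hz => ⟨hz, hs⟩⟩

theorem IsFlatSolution.continuousOn_slice_s (H : IsFlatSolution S ζ h v₀ V W Q f M) {z : ℝ}
    (hz : 0 < z) :
    ContinuousOn (fun s => V z s) (Ioo 0 S) ∧ ContinuousOn (fun s => W z s) (Ioo 0 S) :=
  ⟨H.cont.comp (f := fun s => (z, s)) (by fun_prop) fun _ hs => ⟨hz, hs⟩,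
    H.cont_z.comp (f := fun s => (z, s)) (by fun_prop) fun _ hs => ⟨hz, hs⟩⟩

/-- Green's identity on a rectangle, for the test function `∂ₓ gaussK`. -/
theorem IsFlatSolution.green_rectangle (H : IsFlatSolution S ζ h v₀ V W Q f M)
    (hζ : IsC1Curve S ζ L) {x₀ τ e R a b : ℝ} (he : 0 < e) (heR : e ≤ R) (ha : 0 < a)
    (hab : a ≤ b) (hbτ : b < τ) (hτ : τ ≤ S) :
    ∫ z in e..R, (V z b * gaussK₁ (x₀ - ζ b - z) (τ - b) - V z a * gaussK₁ (x₀ - ζ a - z) (τ - a)) =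
    ∫ s in a..b,
      ((W R s * gaussK₁ (x₀ - ζ s - R) (τ - s) + V R s * gaussK₂ (x₀ - ζ s - R) (τ - s)
        + deriv ζ s * (V R s * gaussK₁ (x₀ - ζ s - R) (τ - s)))
      - (W e s * gaussK₁ (x₀ - ζ s - e) (τ - s) + V e s * gaussK₂ (x₀ - ζ s - e) (τ - s)
        + deriv ζ s * (V e s * gaussK₁ (x₀ - ζ s - e) (τ - s)))) := by
  have hmem : ∀ s ∈ Icc a b, s ∈ Ioo 0 S := fun s hs => ⟨by linarith [hs.1], by linarith [hs.2]⟩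
  -- In `∂_z B` the two products `W G₂` cancel, and the heat equation for the kernel matches the
  -- result with `∂_s A`. The third derivative falls on the kernel only.
  refine integral_sub_eq_integral_sub_of_hasDerivAt
    (A := fun z s => V z s * gaussK₁ (x₀ - ζ s - z) (τ - s))
    (B := fun z s => W z s * gaussK₁ (x₀ - ζ s - z) (τ - s) + V z s * gaussK₂ (x₀ - ζ s - z) (τ - s)
        + deriv ζ s * (V z s * gaussK₁ (x₀ - ζ s - z) (τ - s)))
    (D := fun z s => (Q z s + deriv ζ s * W z s) * gaussK₁ (x₀ - ζ s - z) (τ - s)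
        - V z s * (deriv ζ s * gaussK₂ (x₀ - ζ s - z) (τ - s) + gaussK₃ (x₀ - ζ s - z) (τ - s)))
    heR hab ?_ ?_ ?_
  · intro z hz s hs
    have hz0 : 0 < z := he.trans_le hz.1
    have hX : HasDerivAt (fun s => x₀ - ζ s - z) (-deriv ζ s) s := by
      simpa using ((hasDerivAt_const s x₀).sub (hζ.diff s (hmem s hs)).hasDerivAt).sub_const z
    have hρ : HasDerivAt (fun s => τ - s) (-1) s := by
      simpa using (hasDerivAt_id s).const_sub τ
    refine ((H.hasDerivAt_s z s hz0 (hmem s hs)).mul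
      (hasDerivAt_gaussK₁_comp hX hρ (by linarith [hs.2]))).congr_deriv ?_
    ring
  · intro z hz s hs
    have hz0 : 0 < z := he.trans_le hz.1
    have hr : 0 < τ - s := by linarith [hs.2]
    have hX : HasDerivAt (fun z => x₀ - ζ s - z) (-1) z := by
      simpa using (hasDerivAt_id z).const_sub (x₀ - ζ s)
    have h1 := hasDerivAt_gaussK₁_comp hX (hasDerivAt_const z (τ - s)) hr
    have h2 := hasDerivAt_gaussK₂_comp hX hr
    have hW := H.hasDerivAt_zz z s hz0 (hmem s hs)
    have hV := H.hasDerivAt_z z s hz0 (hmem s hs)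
    refine (((hW.mul h1).add (hV.mul h2)).add ((hV.mul h1).const_mul _)).congr_deriv ?_
    ring
  · have hsub : Icc e R ×ˢ Icc a b ⊆ Ioi 0 ×ˢ Ioo 0 S :=
      prod_mono (fun z hz => he.trans_le hz.1) hmem
    have hV := H.cont.mono hsub
    have hW := H.cont_z.mono hsub
    have hQ := H.cont_zz.mono hsub
    have hζ' : ContinuousOn (fun p : ℝ × ℝ => deriv ζ p.2) (Icc e R ×ˢ Icc a b) :=
      hζ.cont_deriv.comp continuousOn_snd fun p hp => hmem _ hp.2
    have hζc : ContinuousOn (fun p : ℝ × ℝ => ζ p.2) (Icc e R ×ˢ Icc a b) :=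
      hζ.cont.comp continuousOn_snd fun p hp => Ioo_subset_Icc_self (hmem _ hp.2)
    have hX : ContinuousOn (fun p : ℝ × ℝ => x₀ - ζ p.2 - p.1) (Icc e R ×ˢ Icc a b) :=
      (continuousOn_const.sub hζc).sub continuousOn_fst
    have hρ : ContinuousOn (fun p : ℝ × ℝ => τ - p.2) (Icc e R ×ˢ Icc a b) := by fun_prop
    have hpos : ∀ p ∈ Icc e R ×ˢ Icc a b, 0 < τ - p.2 := fun p hp => by linarith [hp.2.2]
    have h1 := continuousOn_gaussK₁ hX hρ hpos
    have h2 := continuousOn_gaussK₂ hX hρ hpos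
    have h3 := continuousOn_gaussK₃ hX hρ hpos
    exact ((hQ.add (hζ'.mul hW)).mul h1).sub (hV.mul ((hζ'.mul h2).add h3))

/-- Stopping at `b < τ` keeps the lag `τ - s` above `τ - b`, and the curve is bounded, so one
Gaussian in `z` serves all times `s ≤ b`. -/
theorem exists_gaussian_majorant_curve (hζ : IsC1Curve S ζ L) (x₀ : ℝ) {τ b : ℝ} (hb : 0 < b)
    (hbτ : b < τ) (hτ : τ ≤ S) :
    ∃ C k : ℝ, 0 ≤ C ∧ 0 < k ∧ ∀ s ∈ Icc 0 b, ∀ z,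
      |gaussK (x₀ - ζ s - z) (τ - s)| ≤ C * exp (-k * z ^ 2) ∧
      |gaussK₁ (x₀ - ζ s - z) (τ - s)| ≤ C * exp (-k * z ^ 2) ∧
      |gaussK₂ (x₀ - ζ s - z) (τ - s)| ≤ C * exp (-k * z ^ 2) := by
  obtain ⟨m, hm⟩ := isCompact_Icc.exists_bound_of_continuousOn
    (show ContinuousOn (fun s => x₀ - ζ s) (Icc 0 S) from continuousOn_const.sub hζ.cont)
  obtain ⟨C, k, hC, hk, h⟩ := exists_gaussian_majorant (r₀ := τ - b) τ m (by linarith) (by linarith)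
  refine ⟨C, k, hC, hk, fun s hs z => h _ _ _ (by linarith [hs.2]) (by linarith [hs.1]) ?_⟩
  exact hm s ⟨hs.1, by linarith [hs.2]⟩

theorem tendsto_mul_exp_neg_mul_sq (C : ℝ) {k : ℝ} (hk : 0 < k) :
    Tendsto (fun z : ℝ => C * exp (-k * z ^ 2)) atTop (𝓝 0) := by
  have h1 : Tendsto (fun z : ℝ => k * z ^ 2) atTop atTop :=
    (tendsto_pow_atTop two_ne_zero).const_mul_atTop hk
  have h2 := (tendsto_exp_neg_atTop_nhds_zero.comp h1).const_mul C
  simpa [Function.comp_def] using h2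

end

section

variable {S L M : ℝ} {ζ h v₀ f : ℝ → ℝ} {V W Q : ℝ → ℝ → ℝ}

/-- Green's identity in the strip `z > 0`, `0 < s < b`, for the test function `∂ₓ gaussK`. -/
theorem IsFlatSolution.green_strip (H : IsFlatSolution S ζ h v₀ V W Q f M)
    (hζ : IsC1Curve S ζ L) {τ b : ℝ} (x₀ : ℝ) (hb : 0 < b) (hbτ : b < τ) (hτ : τ ≤ S) :
    (∫ z in Ioi (0 : ℝ), (V z b * gaussK₁ (x₀ - ζ b - z) (τ - b)
      - v₀ z * gaussK₁ (x₀ - ζ 0 - z) (τ - 0))) =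
    ∫ s in Ioo 0 b, -(f s * gaussK₁ (x₀ - ζ s) (τ - s) + h s * gaussK₂ (x₀ - ζ s) (τ - s)
        + deriv ζ s * (h s * gaussK₁ (x₀ - ζ s) (τ - s))) := by
  have hS : 0 < S := by linarith
  have hbS : b ∈ Ioo 0 S := ⟨hb, by linarith⟩
  have hM : 0 ≤ M := (abs_nonneg _).trans (H.bound 1 b one_pos hbS)
  have hL := hζ.nonneg hS
  obtain ⟨C, k, hC, hk, hmaj⟩ := exists_gaussian_majorant_curve hζ x₀ hb hbτ hτ
  -- One sequence plays two roles: the distance of the rectangle from the boundary and its initial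
  -- time. The `2` keeps it strictly below `b` already at `n = 0`.
  set e : ℕ → ℝ := fun n => b / (n + 2) with he
  set R : ℕ → ℝ := fun n => b + n with hR
  have he0 : ∀ n, 0 < e n := fun n => by simp only [he]; positivity
  have heb : ∀ n, e n < b := fun n => by
    simp only [he]
    rw [div_lt_iff₀ (by positivity)]
    nlinarith [(Nat.cast_nonneg n : (0 : ℝ) ≤ n)]
  have hbR : ∀ n, b ≤ R n := fun n => by simp [hR]
  have hR0 : ∀ n, 0 < R n := fun n => hb.trans_le (hbR n)
  have hetop : Tendsto (fun n : ℕ => (n : ℝ) + 2) atTop atTop :=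
    tendsto_atTop_add_const_right _ _ tendsto_natCast_atTop_atTop
  have he_lim : Tendsto e atTop (𝓝[>] 0) :=
    tendsto_nhdsWithin_iff.2 ⟨hetop.const_div_atTop b, Eventually.of_forall he0⟩
  have hR_lim : Tendsto R atTop atTop :=
    tendsto_atTop_add_const_left _ _ tendsto_natCast_atTop_atTop
  have heS : ∀ n, e n ∈ Ioo 0 S := fun n => ⟨he0 n, (heb n).trans hbS.2⟩
  have hgc : ∀ s ∈ Icc 0 b, ContinuousOn (fun z => gaussK₁ (x₀ - ζ s - z) (τ - s)) (Ioi 0) :=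
    fun s hs => continuousOn_gaussK₁ (by fun_prop) (by fun_prop) fun _ _ => by linarith [hs.2]
  have hgauss : Integrable fun z : ℝ => exp (-k * z ^ 2) := integrable_exp_neg_mul_sq hk
  have hid := fun n => H.green_rectangle hζ (x₀ := x₀) (he0 n) ((heb n).le.trans (hbR n)) (he0 n)
    (heb n).le hbτ hτ
  have hleft : Tendsto (fun n => ∫ z in (e n)..(R n), (V z b * gaussK₁ (x₀ - ζ b - z) (τ - b)
      - V z (e n) * gaussK₁ (x₀ - ζ (e n) - z) (τ - e n))) atTop
      (𝓝 (∫ z in Ioi (0 : ℝ), (V z b * gaussK₁ (x₀ - ζ b - z) (τ - b)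
      - v₀ z * gaussK₁ (x₀ - ζ 0 - z) (τ - 0)))) := by
    have e1 : ∀ n, (∫ z in (e n)..(R n), (V z b * gaussK₁ (x₀ - ζ b - z) (τ - b)
      - V z (e n) * gaussK₁ (x₀ - ζ (e n) - z) (τ - e n))) =
        ∫ z in Ioi (0 : ℝ), (Ioc (e n) (R n)).indicator (fun z =>
          V z b * gaussK₁ (x₀ - ζ b - z) (τ - b)
          - V z (e n) * gaussK₁ (x₀ - ζ (e n) - z) (τ - e n)) z := by
      intro n
      rw [intervalIntegral.integral_of_le ((heb n).le.trans (hbR n)),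
        setIntegral_indicator measurableSet_Ioc]
      congr 2
      exact (inter_eq_right.2 fun z hz => (he0 n).trans hz.1).symm
    simp_rw [e1]
    refine tendsto_integral_of_dominated_convergence
      (fun z => 2 * M * (C * exp (-k * z ^ 2))) ?_ ?_ ?_ ?_
    · intro n
      refine AEStronglyMeasurable.indicator ?_ measurableSet_Ioc
      refine ContinuousOn.aestronglyMeasurable ?_ measurableSet_Ioi
      exact ((H.continuousOn_slice_z hbS).1.mul (hgc b ⟨hb.le, le_rfl⟩)).sub
        ((H.continuousOn_slice_z (heS n)).1.mul (hgc _ ⟨(he0 n).le, (heb n).le⟩))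
    · exact ((hgauss.const_mul C).const_mul _).integrableOn
    · intro n
      refine (ae_restrict_mem measurableSet_Ioi).mono fun z hz => ?_
      refine (norm_indicator_le_norm_self _ _).trans ?_
      have h1 := (hmaj b ⟨hb.le, le_rfl⟩ z).2.1
      have h2 := (hmaj (e n) ⟨(he0 n).le, (heb n).le⟩ z).2.1
      have h3 := H.bound z b hz hbS
      have h4 := H.bound z (e n) hz (heS n)
      refine (norm_sub_le _ _).trans ?_
      rw [norm_mul, norm_mul, norm_eq_abs, norm_eq_abs, norm_eq_abs, norm_eq_abs]
      have h5 := mul_le_mul h3 h1 (abs_nonneg _) hM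
      have h6 := mul_le_mul h4 h2 (abs_nonneg _) hM
      linarith
    · refine (ae_restrict_mem measurableSet_Ioi).mono fun z hz => ?_
      have hz : 0 < z := hz
      have hev : ∀ᶠ n in atTop, z ∈ Ioc (e n) (R n) := by
        filter_upwards [(he_lim.mono_right nhdsWithin_le_nhds).eventually_lt_const hz,
          hR_lim.eventually_ge_atTop z] with n h1 h2 using ⟨h1, h2⟩
      have hg : ContinuousWithinAt (fun s => gaussK₁ (x₀ - ζ s - z) (τ - s)) (Icc 0 b) 0 := by
        refine (continuousOn_gaussK₁ ?_ (by fun_prop) fun s hs => by linarith [hs.2]) 0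
          ⟨le_rfl, hb.le⟩
        have := hζ.cont.mono (Icc_subset_Icc_right hbS.2.le)
        exact (continuousOn_const.sub this).sub continuousOn_const
      have he' : Tendsto e atTop (𝓝[Icc 0 b] 0) :=
        tendsto_nhdsWithin_iff.2 ⟨he_lim.mono_right nhdsWithin_le_nhds,
          Eventually.of_forall fun n => ⟨(he0 n).le, (heb n).le⟩⟩
      have hlim := ((tendsto_const_nhds (x := V z b * gaussK₁ (x₀ - ζ b - z) (τ - b))).sub
        (((H.initial z hz).comp he_lim).mul (hg.tendsto.comp he')))
      refine hlim.congr' ?_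
      filter_upwards [hev] with n hn
      rw [indicator_of_mem hn]; rfl
  have hright : Tendsto (fun n => ∫ s in (e n)..b,
      ((W (R n) s * gaussK₁ (x₀ - ζ s - R n) (τ - s) + V (R n) s * gaussK₂ (x₀ - ζ s - R n) (τ - s)
        + deriv ζ s * (V (R n) s * gaussK₁ (x₀ - ζ s - R n) (τ - s)))
      - (W (e n) s * gaussK₁ (x₀ - ζ s - e n) (τ - s) + V (e n) s * gaussK₂ (x₀ - ζ s - e n) (τ - s)
        + deriv ζ s * (V (e n) s * gaussK₁ (x₀ - ζ s - e n) (τ - s))))) atTop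
      (𝓝 (∫ s in Ioo 0 b, -(f s * gaussK₁ (x₀ - ζ s) (τ - s) + h s * gaussK₂ (x₀ - ζ s) (τ - s)
        + deriv ζ s * (h s * gaussK₁ (x₀ - ζ s) (τ - s))))) := by
    have hsub : Ioo 0 b ⊆ Ioo 0 S := Ioo_subset_Ioo_right hbS.2.le
    have hζc := hζ.cont.mono (hsub.trans Ioo_subset_Icc_self)
    set B : ℝ → ℝ → ℝ := fun z s => W z s * gaussK₁ (x₀ - ζ s - z) (τ - s)
      + V z s * gaussK₂ (x₀ - ζ s - z) (τ - s)
        + deriv ζ s * (V z s * gaussK₁ (x₀ - ζ s - z) (τ - s)) with hB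
    have hBc : ∀ z, 0 < z → ContinuousOn (B z) (Ioo 0 b) := by
      intro z hz
      have hX : ContinuousOn (fun s => x₀ - ζ s - z) (Ioo 0 b) :=
        (continuousOn_const.sub hζc).sub continuousOn_const
      have hρ : ContinuousOn (fun s => τ - s) (Ioo 0 b) := by fun_prop
      have hpos : ∀ s ∈ Ioo 0 b, 0 < τ - s := fun s hs => by linarith [hs.2]
      have h1 := continuousOn_gaussK₁ hX hρ hpos
      have h2 := continuousOn_gaussK₂ hX hρ hpos
      have hV := (H.continuousOn_slice_s hz).1.mono hsub
      have hW := (H.continuousOn_slice_s hz).2.mono hsub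
      exact ((hW.mul h1).add (hV.mul h2)).add ((hζ.cont_deriv.mono hsub).mul (hV.mul h1))
    have hBb : ∀ z s, 0 < z → s ∈ Ioo 0 b → |B z s| ≤ (2 * M + L * M) * (C * exp (-k * z ^ 2)) := by
      intro z s hz hs
      have hsS := hsub hs
      obtain ⟨-, h1, h2⟩ := hmaj s ⟨hs.1.le, hs.2.le⟩ z
      have hV := H.bound z s hz hsS
      have hW := H.bound_z z s hz hsS
      have hZ := hζ.bound s hsS
      have hE : 0 ≤ C * exp (-k * z ^ 2) := by positivity
      have a1 := mul_le_mul hW h1 (abs_nonneg _) hM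
      have a2 := mul_le_mul hV h2 (abs_nonneg _) hM
      have a3 := mul_le_mul hZ (mul_le_mul hV h1 (abs_nonneg _) hM) (by positivity) hL
      rw [← abs_mul] at a1 a2
      rw [← abs_mul, ← abs_mul] at a3
      refine (abs_add_le _ _).trans ?_
      have := abs_add_le (W z s * gaussK₁ (x₀ - ζ s - z) (τ - s))
        (V z s * gaussK₂ (x₀ - ζ s - z) (τ - s))
      linarith
    have hBb' : ∀ z s, 0 < z → s ∈ Ioo 0 b → |B z s| ≤ (2 * M + L * M) * C := by
      intro z s hz hs
      refine (hBb z s hz hs).trans ?_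
      have : exp (-k * z ^ 2) ≤ 1 := by
        rw [exp_le_one_iff]; nlinarith [mul_nonneg hk.le (sq_nonneg z)]
      have : C * exp (-k * z ^ 2) ≤ C := mul_le_of_le_one_right hC this
      gcongr
    have e1 : ∀ n, (∫ s in (e n)..b, (B (R n) s - B (e n) s)) =
        ∫ s in Ioo 0 b, (Ioo (e n) b).indicator (fun s => B (R n) s - B (e n) s) s := by
      intro n
      rw [intervalIntegral.integral_of_le (heb n).le, integral_Ioc_eq_integral_Ioo,
        setIntegral_indicator measurableSet_Ioo]
      congr 2
      exact (inter_eq_right.2 (Ioo_subset_Ioo_left (he0 n).le)).symm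
    change Tendsto (fun n => ∫ s in (e n)..b, (B (R n) s - B (e n) s)) atTop _
    simp_rw [e1]
    refine tendsto_integral_of_dominated_convergence
      (fun _ => 2 * ((2 * M + L * M) * C)) ?_ ?_ ?_ ?_
    · intro n
      refine AEStronglyMeasurable.indicator ?_ measurableSet_Ioo
      exact ((hBc _ (hR0 n)).sub (hBc _ (he0 n))).aestronglyMeasurable measurableSet_Ioo
    · exact integrable_const _
    · intro n
      refine (ae_restrict_mem measurableSet_Ioo).mono fun s hs => ?_
      refine (norm_indicator_le_norm_self _ _).trans ?_
      refine (norm_sub_le _ _).trans ?_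
      rw [norm_eq_abs, norm_eq_abs]
      linarith [hBb' _ s (hR0 n) hs, hBb' _ s (he0 n) hs]
    · refine (ae_restrict_mem measurableSet_Ioo).mono fun s hs => ?_
      have hr : 0 < τ - s := by linarith [hs.2]
      have hev : ∀ᶠ n in atTop, s ∈ Ioo (e n) b := by
        filter_upwards [(he_lim.mono_right nhdsWithin_le_nhds).eventually_lt_const hs.1]
          with n h1 using ⟨h1, hs.2⟩
      -- The far edge disappears through Gaussian decay, as `V` and `V_z` are bounded.
      have hlim1 : Tendsto (fun n => B (R n) s) atTop (𝓝 0) := by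
        refine squeeze_zero_norm (fun n => hBb _ s (hR0 n) hs) ?_
        have := ((tendsto_mul_exp_neg_mul_sq C hk).comp hR_lim).const_mul (2 * M + L * M)
        simpa [Function.comp_def] using this
      have hX : ContinuousOn (fun z : ℝ => x₀ - ζ s - z) univ := by fun_prop
      have h1 : Tendsto (fun z => gaussK₁ (x₀ - ζ s - z) (τ - s)) (𝓝[>] 0)
          (𝓝 (gaussK₁ (x₀ - ζ s) (τ - s))) := by
        have := ((continuousOn_gaussK₁ hX (continuousOn_const (c := τ - s))
          fun _ _ => hr).continuousAt
          (x := (0 : ℝ)) univ_mem).tendsto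
        rw [sub_zero] at this
        exact this.mono_left nhdsWithin_le_nhds
      have h2 : Tendsto (fun z => gaussK₂ (x₀ - ζ s - z) (τ - s)) (𝓝[>] 0)
          (𝓝 (gaussK₂ (x₀ - ζ s) (τ - s))) := by
        have := ((continuousOn_gaussK₂ hX (continuousOn_const (c := τ - s))
          fun _ _ => hr).continuousAt
          (x := (0 : ℝ)) univ_mem).tendsto
        rw [sub_zero] at this
        exact this.mono_left nhdsWithin_le_nhds
      have hV := H.boundary s (hsub hs)
      have hW := H.flux s (hsub hs)
      have hlim2 := (((hW.mul h1).add (hV.mul h2)).add ((hV.mul h1).const_mul (deriv ζ s))).comp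
        he_lim
      have hlim := hlim1.sub hlim2
      rw [zero_sub] at hlim
      refine hlim.congr' ?_
      filter_upwards [hev] with n hn
      rw [indicator_of_mem hn]; rfl
  simp_rw [hid] at hleft
  exact tendsto_nhds_unique hleft hright

end

/-! ### Integration by parts and the layer representation -/

theorem continuous_gaussK_sub (c : ℝ) {r : ℝ} (hr : 0 < r) :
    Continuous fun z => gaussK (c - z) r :=
  continuousOn_univ.1 <| continuousOn_gaussK (by fun_prop) (by fun_prop) fun _ _ => hr

theorem continuous_gaussK₁_sub (c : ℝ) {r : ℝ} (hr : 0 < r) :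
    Continuous fun z => gaussK₁ (c - z) r :=
  continuousOn_univ.1 <| continuousOn_gaussK₁ (by fun_prop) (by fun_prop) fun _ _ => hr

theorem integrableOn_mul_of_abs_le_gaussian {φ g : ℝ → ℝ} {M C k : ℝ} {A : Set ℝ}
    (hA : MeasurableSet A) (hk : 0 < k)
    (hφ : ContinuousOn φ A) (hg : ContinuousOn g A) (hφb : ∀ z ∈ A, |φ z| ≤ M)
    (hgb : ∀ z ∈ A, |g z| ≤ C * exp (-k * z ^ 2)) :
    IntegrableOn (fun z => φ z * g z) A := by
  have hi : Integrable fun z : ℝ => M * (C * exp (-k * z ^ 2)) :=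
    ((integrable_exp_neg_mul_sq hk).const_mul C).const_mul M
  refine hi.integrableOn.mono' ((hφ.mul hg).aestronglyMeasurable hA) ?_
  refine (ae_restrict_mem hA).mono fun z hz => ?_
  rw [norm_mul]
  exact mul_le_mul (hφb z hz) (hgb z hz) (abs_nonneg _) ((abs_nonneg _).trans (hφb z hz))

/-- Integration by parts against `∂ₓ gaussK` on a half-line. -/
theorem integral_mul_gaussK₁ {φ φ' : ℝ → ℝ} {M φ₀ c r : ℝ} (hr : 0 < r)
    (hφ : ∀ z, 0 < z → HasDerivAt φ (φ' z) z) (hb : ∀ z, 0 < z → |φ z| ≤ M)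
    (h0 : Tendsto φ (𝓝[>] 0) (𝓝 φ₀))
    (hi : IntegrableOn (fun z => φ' z * gaussK (c - z) r) (Ioi 0)) :
    IntegrableOn (fun z => φ z * gaussK₁ (c - z) r) (Ioi 0) ∧
    ∫ z in Ioi (0 : ℝ), φ z * gaussK₁ (c - z) r
      = φ₀ * gaussK c r + ∫ z in Ioi (0 : ℝ), φ' z * gaussK (c - z) r := by
  obtain ⟨C, k, hC, hk, hmaj⟩ := exists_gaussian_majorant r |c| hr le_rfl
  have hφc : ContinuousOn φ (Ioi 0) := fun z hz => (hφ z hz).continuousAt.continuousWithinAt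
  have hI : IntegrableOn (fun z => φ z * gaussK₁ (c - z) r) (Ioi 0) :=
    integrableOn_mul_of_abs_le_gaussian measurableSet_Ioi hk hφc
      (continuous_gaussK₁_sub c hr).continuousOn hb
      (fun z _ => (hmaj c r z le_rfl le_rfl le_rfl).2.1)
  refine ⟨hI, ?_⟩
  have hv : ∀ z ∈ Ioi (0 : ℝ), HasDerivAt (fun z => -gaussK (c - z) r) (gaussK₁ (c - z) r) z := by
    intro z _
    have hX : HasDerivAt (fun z => c - z) (-1) z := by
      simpa using (hasDerivAt_id z).const_sub c
    refine (hasDerivAt_gaussK_comp hX (hasDerivAt_const z r) hr).neg.congr_deriv ?_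
    ring
  have hlim0 : Tendsto (φ * fun z => -gaussK (c - z) r) (𝓝[>] 0) (𝓝 (φ₀ * -gaussK c r)) := by
    refine h0.mul ?_
    have := ((continuous_gaussK_sub c hr).tendsto 0).neg
    rw [sub_zero] at this
    exact this.mono_left nhdsWithin_le_nhds
  have hlim1 : Tendsto (φ * fun z => -gaussK (c - z) r) atTop (𝓝 0) := by
    have hlim := (tendsto_mul_exp_neg_mul_sq C hk).const_mul M
    rw [mul_zero] at hlim
    refine squeeze_zero_norm' ?_ hlim
    filter_upwards [eventually_gt_atTop 0] with z hz
    rw [Pi.mul_apply, norm_mul, norm_neg]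
    exact mul_le_mul (hb z hz) (hmaj c r z le_rfl le_rfl le_rfl).1 (abs_nonneg _)
      ((abs_nonneg _).trans (hb z hz))
  have hi' : IntegrableOn (φ' * fun z => -gaussK (c - z) r) (Ioi 0) := by
    have := hi.neg
    refine this.congr_fun (fun z _ => ?_) measurableSet_Ioi
    simp
  rw [integral_Ioi_mul_deriv_eq_deriv_mul (u := φ) (v := fun z => -gaussK (c - z) r)
    (fun z hz => hφ z hz) hv hI hi' hlim0 hlim1]
  simp only [mul_neg, integral_neg]
  ring

theorem integrableOn_mul_gaussK {φ : ℝ → ℝ} {A : Set ℝ} {c r : ℝ} (hr : 0 < r)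
    (hφ : IntegrableOn φ A) : IntegrableOn (fun z => φ z * gaussK (c - z) r) A := by
  refine Integrable.mul_bdd (c := 1 / √r) hφ
    (continuous_gaussK_sub c hr).aestronglyMeasurable ?_
  refine Eventually.of_forall fun z => ?_
  rw [norm_eq_abs, abs_of_nonneg (gaussK_nonneg _ _)]
  exact gaussK_le

section

variable {S L L' M : ℝ} {ζ h v₀ f : ℝ → ℝ} {V W Q : ℝ → ℝ → ℝ}

theorem IsFlatSolution.abs_flux_le (H : IsFlatSolution S ζ h v₀ V W Q f M) {s : ℝ}
    (hs : s ∈ Ioo 0 S) : |f s| ≤ M :=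
  le_of_tendsto (H.flux s hs).abs (by
    filter_upwards [self_mem_nhdsWithin] with z hz using H.bound_z z s hz hs)

theorem IsFlatSolution.abs_initial_le (H : IsFlatSolution S ζ h v₀ V W Q f M) (hS : 0 < S) {z : ℝ}
    (hz : 0 < z) : |v₀ z| ≤ M :=
  le_of_tendsto (H.initial z hz).abs (by
    filter_upwards [Ioo_mem_nhdsGT hS] with s hs using H.bound z s hz hs)

/-- The flux is assumed only as a pointwise limit, so its continuity in time is not available here.
Measurability comes from the continuous functions `W(1/(n+1), ·)`. -/
theorem IsFlatSolution.aestronglyMeasurable_flux (H : IsFlatSolution S ζ h v₀ V W Q f M) :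
    AEStronglyMeasurable f (volume.restrict (Ioo 0 S)) := by
  have hlim : Tendsto (fun n : ℕ => 1 / ((n : ℝ) + 1)) atTop (𝓝[>] 0) :=
    tendsto_nhdsWithin_iff.2 ⟨tendsto_one_div_add_atTop_nhds_zero_nat,
      Eventually.of_forall fun n => by simp only [mem_Ioi]; positivity⟩
  refine aestronglyMeasurable_of_tendsto_ae atTop
    (f := fun (n : ℕ) s => W (1 / ((n : ℝ) + 1)) s) (fun n => ?_) ?_
  · exact (H.continuousOn_slice_s (by positivity)).2.aestronglyMeasurable measurableSet_Ioo
  · exact (ae_restrict_mem measurableSet_Ioo).mono fun s hs => (H.flux s hs).comp hlim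

theorem integrableOn_Ioo_of_abs_le {φ : ℝ → ℝ} {a b C : ℝ}
    (hm : AEStronglyMeasurable φ (volume.restrict (Ioo a b))) (hb : ∀ s ∈ Ioo a b, |φ s| ≤ C) :
    IntegrableOn φ (Ioo a b) :=
  Integrable.of_bound hm C ((ae_restrict_mem measurableSet_Ioo).mono hb)

/-- The layer representation of `W`, before the time `τ` of the singularity is reached. -/
theorem IsFlatSolution.representation (H : IsFlatSolution S ζ h v₀ V W Q f M)
    (hζ : IsC1Curve S ζ L) (hh : IsC1Curve S h L') (hv₀ : ∀ z, 0 < z → DifferentiableAt ℝ v₀ z)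
    (hv₀0 : Tendsto v₀ (𝓝[>] 0) (𝓝 (h 0))) (hv₀i : IntegrableOn (deriv v₀) (Ioi 0))
    {τ b : ℝ} (x₀ : ℝ) (hb : 0 < b) (hbτ : b < τ) (hτ : τ ≤ S) :
    ∫ z in Ioi (0 : ℝ), W z b * gaussK (x₀ - ζ b - z) (τ - b) =
      (∫ z in Ioi (0 : ℝ), deriv v₀ z * gaussK (x₀ - ζ 0 - z) τ)
      - (∫ s in Ioo 0 b, f s * gaussK₁ (x₀ - ζ s) (τ - s))
      - ∫ s in Ioo 0 b, deriv h s * gaussK (x₀ - ζ s) (τ - s) := by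
  have hS : 0 < S := by linarith
  have hbS : b ∈ Ioo 0 S := ⟨hb, by linarith⟩
  have hL := hζ.nonneg hS
  obtain ⟨C, k, hC, hk, hmaj⟩ := exists_gaussian_majorant_curve hζ x₀ hb hbτ hτ
  have hmaj0 : ∀ s ∈ Icc 0 b, |gaussK (x₀ - ζ s) (τ - s)| ≤ C ∧ |gaussK₁ (x₀ - ζ s) (τ - s)| ≤ C ∧
      |gaussK₂ (x₀ - ζ s) (τ - s)| ≤ C := fun s hs => by simpa using hmaj s hs 0
  have hgreen := H.green_strip hζ x₀ hb hbτ hτ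
  have hWi : IntegrableOn (fun z => W z b * gaussK (x₀ - ζ b - z) (τ - b)) (Ioi 0) :=
    integrableOn_mul_of_abs_le_gaussian measurableSet_Ioi hk
      (H.continuousOn_slice_z hbS).2 (continuous_gaussK_sub _ (by linarith)).continuousOn
      (fun z hz => H.bound_z z b hz hbS) (fun z _ => (hmaj b ⟨hb.le, le_rfl⟩ z).1)
  obtain ⟨hI1, hV1⟩ := integral_mul_gaussK₁ (show 0 < τ - b by linarith)
    (fun z hz => H.hasDerivAt_z z b hz hbS) (fun z hz => H.bound z b hz hbS) (H.boundary b hbS) hWi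
  obtain ⟨hI2, hV2⟩ := integral_mul_gaussK₁ (c := x₀ - ζ 0) (show 0 < τ - 0 by linarith)
    (fun z hz => (hv₀ z hz).hasDerivAt) (fun z hz => H.abs_initial_le hS hz) hv₀0
    (integrableOn_mul_gaussK (by linarith) hv₀i)
  rw [integral_sub hI1 hI2, hV1, hV2] at hgreen
  have hsub : Ioo 0 b ⊆ Ioo 0 S := Ioo_subset_Ioo_right hbS.2.le
  have hsub' : Icc 0 b ⊆ Icc 0 S := Icc_subset_Icc_right hbS.2.le
  have hX : ContinuousOn (fun s => x₀ - ζ s) (Icc 0 b) :=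
    continuousOn_const.sub (hζ.cont.mono hsub')
  have hρ : ContinuousOn (fun s => τ - s) (Icc 0 b) := by fun_prop
  have hpos : ∀ s ∈ Icc 0 b, 0 < τ - s := fun s hs => by linarith [hs.2]
  have c0 := continuousOn_gaussK hX hρ hpos
  have c1 := (continuousOn_gaussK₁ hX hρ hpos).mono Ioo_subset_Icc_self
  have c2 := (continuousOn_gaussK₂ hX hρ hpos).mono Ioo_subset_Icc_self
  obtain ⟨m, hm⟩ := isCompact_Icc.exists_bound_of_continuousOn hh.cont
  have hm' : ∀ s ∈ Ioo 0 b, |h s| ≤ m := fun s hs => hm s (Ioo_subset_Icc_self (hsub hs))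
  have hhc := hh.cont.mono (hsub.trans Ioo_subset_Icc_self)
  have i1 : IntegrableOn (fun s => f s * gaussK₁ (x₀ - ζ s) (τ - s)) (Ioo 0 b) := by
    refine integrableOn_Ioo_of_abs_le (C := M * C) ?_ fun s hs => ?_
    · exact (H.aestronglyMeasurable_flux.mono_measure (Measure.restrict_mono hsub le_rfl)).mul
        (c1.aestronglyMeasurable measurableSet_Ioo)
    · rw [abs_mul]
      have := H.abs_flux_le (hsub hs)
      exact mul_le_mul this (hmaj0 s (Ioo_subset_Icc_self hs)).2.1 (abs_nonneg _)
        ((abs_nonneg _).trans this)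
  have i2 : IntegrableOn (fun s => h s * gaussK₂ (x₀ - ζ s) (τ - s)) (Ioo 0 b) := by
    refine integrableOn_Ioo_of_abs_le (C := m * C)
      ((hhc.mul c2).aestronglyMeasurable measurableSet_Ioo) fun s hs => ?_
    rw [abs_mul]
    exact mul_le_mul (hm' s hs) (hmaj0 s (Ioo_subset_Icc_self hs)).2.2 (abs_nonneg _)
      ((abs_nonneg _).trans (hm' s hs))
  have i3 : IntegrableOn (fun s => deriv ζ s * (h s * gaussK₁ (x₀ - ζ s) (τ - s))) (Ioo 0 b) := by
    refine integrableOn_Ioo_of_abs_le (C := L * (m * C))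
      (((hζ.cont_deriv.mono hsub).mul (hhc.mul c1)).aestronglyMeasurable measurableSet_Ioo)
      fun s hs => ?_
    rw [abs_mul, abs_mul]
    exact mul_le_mul (hζ.bound s (hsub hs)) (mul_le_mul (hm' s hs)
      (hmaj0 s (Ioo_subset_Icc_self hs)).2.1 (abs_nonneg _)
      ((abs_nonneg _).trans (hm' s hs))) (by positivity) hL
  have i4 : IntegrableOn (fun s => deriv h s * gaussK (x₀ - ζ s) (τ - s)) (Ioo 0 b) := by
    refine integrableOn_Ioo_of_abs_le (C := L' * C)
      (((hh.cont_deriv.mono hsub).mul (c0.mono Ioo_subset_Icc_self)).aestronglyMeasurable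
        measurableSet_Ioo) fun s hs => ?_
    rw [abs_mul]
    exact mul_le_mul (hh.bound s (hsub hs)) (hmaj0 s (Ioo_subset_Icc_self hs)).1 (abs_nonneg _)
      (hh.nonneg hS)
  have i23 : IntegrableOn (fun s => h s * gaussK₂ (x₀ - ζ s) (τ - s)
      + deriv ζ s * (h s * gaussK₁ (x₀ - ζ s) (τ - s))) (Ioo 0 b) := i2.add i3
  have i12 : IntegrableOn (fun s => f s * gaussK₁ (x₀ - ζ s) (τ - s)
      + h s * gaussK₂ (x₀ - ζ s) (τ - s)) (Ioo 0 b) := i1.add i2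
  -- Differentiating `h G` along the curve trades the term `h G₂` and the drift term for `h' G`. The
  -- endpoint values cancel the boundary terms of the two spatial integrations by parts; at time
  -- zero this uses that `v₀` tends to `h 0`.
  have hFTC : ∫ s in (0 : ℝ)..b, (deriv h s * gaussK (x₀ - ζ s) (τ - s)
      - (h s * gaussK₂ (x₀ - ζ s) (τ - s) + deriv ζ s * (h s * gaussK₁ (x₀ - ζ s) (τ - s))))
      = h b * gaussK (x₀ - ζ b) (τ - b) - h 0 * gaussK (x₀ - ζ 0) (τ - 0) := by
    refine intervalIntegral.integral_eq_sub_of_hasDerivAt_of_le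
      (f := fun s => h s * gaussK (x₀ - ζ s) (τ - s)) hb.le
      ((hh.cont.mono hsub').mul c0) ?_ ?_
    · intro s hs
      have hX : HasDerivAt (fun s => x₀ - ζ s) (-deriv ζ s) s := by
        simpa using (hζ.diff s (hsub hs)).hasDerivAt.const_sub x₀
      have hρ : HasDerivAt (fun s => τ - s) (-1) s := by
        simpa using (hasDerivAt_id s).const_sub τ
      refine ((hh.diff s (hsub hs)).hasDerivAt.mul
        (hasDerivAt_gaussK_comp hX hρ (by linarith [hs.2]))).congr_deriv ?_
      ring
    · rw [intervalIntegrable_iff_integrableOn_Ioo_of_le hb.le]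
      exact i4.sub i23
  rw [intervalIntegral.integral_of_le hb.le, integral_Ioc_eq_integral_Ioo,
    integral_sub i4 i23, integral_add i2 i3] at hFTC
  rw [integral_neg, integral_add i12 i3, integral_add i1 i2] at hgreen
  rw [sub_zero] at hgreen hFTC
  linarith

end

/-! ### Cancellation of the jumps and the approximate identity -/

theorem abs_exp_neg_sub_exp_le (x : ℝ) : |exp (-x) - exp x| ≤ 2 * |x| * exp |x| := by
  have key : ∀ y : ℝ, 0 ≤ y → exp y - exp (-y) ≤ 2 * y * exp y := by
    intro y hy
    have h1 : exp (-y) = exp y * exp (-(2 * y)) := by rw [← exp_add]; ring_nf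
    have h2 := add_one_le_exp (-(2 * y))
    rw [h1]
    nlinarith [exp_pos y]
  rcases le_total 0 x with h | h
  · rw [abs_of_nonneg h, abs_sub_comm, abs_of_nonneg]
    · exact key x h
    · rw [sub_nonneg, exp_le_exp]; linarith
  · rw [abs_of_nonpos h, abs_of_nonneg]
    · have := key (-x) (by linarith)
      rwa [neg_neg] at this
    · rw [sub_nonneg, exp_le_exp]; linarith

/-- The jump terms of the two one-sided double layer kernels cancel. -/
theorem abs_gaussK₁_add_gaussK₁_le {L Δ η r : ℝ} (hL : 0 ≤ L) (hr : 0 < r) (hΔ : |Δ| ≤ L * r)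
    (hη : 0 ≤ η) (hη1 : η ≤ 1) :
    |gaussK₁ (Δ + η) r + gaussK₁ (Δ - η) r| ≤ (L + 2 * L * exp (L / 2)) / √r := by
  have hq : 0 < √r := by positivity
  have hΔr : |Δ| / r ≤ L := by rwa [div_le_iff₀ hr]
  -- In the first part `Δ / r` is bounded by the Lipschitz constant. In the second, the dangerous
  -- factor `η / r` multiplies a difference of kernels that is itself small.
  have e1 : gaussK₁ (Δ + η) r + gaussK₁ (Δ - η) r =
      -(Δ / (2 * r) * (gaussK (Δ + η) r + gaussK (Δ - η) r))
      - η / (2 * r) * (gaussK (Δ + η) r - gaussK (Δ - η) r) := by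
    unfold gaussK₁; field_simp; ring
  have b1 : |Δ / (2 * r) * (gaussK (Δ + η) r + gaussK (Δ - η) r)| ≤ L / √r := by
    rw [abs_mul, abs_div, abs_of_pos (show 0 < 2 * r by positivity),
      abs_of_nonneg (add_nonneg (gaussK_nonneg _ _) (gaussK_nonneg _ _))]
    have h1 : gaussK (Δ + η) r + gaussK (Δ - η) r ≤ 2 / √r := by
      have a := gaussK_le (x := Δ + η) (r := r)
      have b := gaussK_le (x := Δ - η) (r := r)
      have : 2 / √r = 1 / √r + 1 / √r := by ring
      linarith
    calc |Δ| / (2 * r) * (gaussK (Δ + η) r + gaussK (Δ - η) r)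
        ≤ |Δ| / (2 * r) * (2 / √r) := by gcongr
      _ = |Δ| / r / √r := by field_simp
      _ ≤ L / √r := by gcongr
  -- Expanding the squares isolates the cross term `Δη / (2r)`, of size at most `Lη / 2`. This
  -- yields a second factor `η`, and `η² / r` is absorbed by `exp(-η² / (4r))` uniformly in `η`.
  have e2 : gaussK (Δ + η) r - gaussK (Δ - η) r =
      exp (-(Δ ^ 2 / (4 * r))) * exp (-(η ^ 2 / (4 * r)))
      * (exp (-(Δ * η / (2 * r))) - exp (Δ * η / (2 * r))) / √r := by
    unfold gaussK
    rw [mul_sub, ← exp_add, ← exp_add, ← exp_add, sub_div]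
    congr 3 <;> field_simp <;> ring
  have b2 : |η / (2 * r) * (gaussK (Δ + η) r - gaussK (Δ - η) r)| ≤ 2 * L * exp (L / 2) / √r := by
    rw [e2, abs_mul (η / (2 * r)), abs_of_nonneg (show 0 ≤ η / (2 * r) by positivity),
      abs_div _ (√r), abs_of_pos hq, abs_mul, abs_mul, abs_exp, abs_exp]
    have hx : |Δ * η / (2 * r)| ≤ L * η / 2 := by
      rw [abs_div, abs_mul, abs_of_nonneg hη, abs_of_pos (show 0 < 2 * r by positivity)]
      calc |Δ| * η / (2 * r) = |Δ| / r * η / 2 := by field_simp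
        _ ≤ L * η / 2 := by gcongr
    have hx1 : |Δ * η / (2 * r)| ≤ L / 2 := hx.trans (by nlinarith)
    have h3 : |exp (-(Δ * η / (2 * r))) - exp (Δ * η / (2 * r))| ≤ L * η * exp (L / 2) := by
      refine (abs_exp_neg_sub_exp_le _).trans ?_
      calc 2 * |Δ * η / (2 * r)| * exp |Δ * η / (2 * r)|
          ≤ 2 * (L * η / 2) * exp (L / 2) := by gcongr
        _ = _ := by ring
    have h4 : exp (-(Δ ^ 2 / (4 * r))) ≤ 1 := by
      rw [exp_le_one_iff]
      have : 0 ≤ Δ ^ 2 / (4 * r) := by positivity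
      linarith
    have h5 : η ^ 2 / (4 * r) * exp (-(η ^ 2 / (4 * r))) ≤ 1 := by
      rw [exp_neg, ← div_eq_mul_inv, div_le_one (exp_pos _)]
      linarith [add_one_le_exp (η ^ 2 / (4 * r))]
    calc η / (2 * r) * (exp (-(Δ ^ 2 / (4 * r))) * exp (-(η ^ 2 / (4 * r)))
          * |exp (-(Δ * η / (2 * r))) - exp (Δ * η / (2 * r))| / √r)
        ≤ η / (2 * r) * (1 * exp (-(η ^ 2 / (4 * r))) * (L * η * exp (L / 2)) / √r) := by gcongr
      _ = 2 * L * exp (L / 2) / √r * (η ^ 2 / (4 * r) * exp (-(η ^ 2 / (4 * r)))) := by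
          field_simp; ring
      _ ≤ 2 * L * exp (L / 2) / √r * 1 := by gcongr
      _ = _ := by ring
  rw [e1, add_div]
  refine (abs_sub _ _).trans ?_
  rw [abs_neg]
  exact add_le_add b1 b2

theorem abs_gaussK_add_gaussK_le (x y : ℝ) {r : ℝ} :
    |gaussK x r + gaussK y r| ≤ 2 / √r := by
  rw [abs_of_nonneg (add_nonneg (gaussK_nonneg _ _) (gaussK_nonneg _ _))]
  have a := gaussK_le (x := x) (r := r)
  have b := gaussK_le (x := y) (r := r)
  have : 2 / √r = 1 / √r + 1 / √r := by ring
  linarith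

/-- The scaling `z = c - √r q` moves the singularity as `r → 0` from the kernel into the argument of
`U`, leaving a fixed Gaussian weight. -/
theorem integral_gaussK_eq (U : ℝ → ℝ) (c : ℝ) {r : ℝ} (hr : 0 < r) :
    ∫ z, U z * gaussK (c - z) r = ∫ q, U (c - √r * q) * exp (-(1 / 4) * q ^ 2) := by
  have hq : 0 < √r := by positivity
  rw [← integral_sub_left_eq_self (fun z => U z * gaussK (c - z) r) volume c]
  have h := Measure.integral_comp_mul_left (fun y => U (c - y) * gaussK (c - (c - y)) r) (√r)
  rw [abs_of_pos (inv_pos.2 hq), smul_eq_mul, inv_mul_eq_div, eq_div_iff hq.ne'] at h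
  rw [← h, ← integral_mul_const]
  refine integral_congr_ae (Eventually.of_forall fun q => ?_)
  have h4 : √r ^ 2 = r := sq_sqrt hr.le
  have : -(c - (c - √r * q)) ^ 2 / (4 * r) = -(1 / 4) * q ^ 2 := by
    rw [sub_sub_cancel, mul_pow, h4]; field_simp
  simp only [gaussK, this]
  field_simp

/-- The heat kernel is an approximate identity, with total mass `2 √π` in this normalization. -/
theorem tendsto_integral_gaussK {U : ℝ → ℝ → ℝ} {c : ℝ → ℝ} {M z₀ τ l : ℝ}
    (hm : ∀ᶠ b in 𝓝[<] τ, Measurable fun z => U z b)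
    (hb : ∀ᶠ b in 𝓝[<] τ, ∀ z, |U z b| ≤ M) (hc : Tendsto c (𝓝[<] τ) (𝓝 z₀))
    (hU : Tendsto (fun p : ℝ × ℝ => U p.1 p.2) (𝓝 (z₀, τ)) (𝓝 l)) :
    Tendsto (fun b => ∫ z, U z b * gaussK (c b - z) (τ - b)) (𝓝[<] τ) (𝓝 (l * (2 * √π))) := by
  have hI : ∫ q : ℝ, l * exp (-(1 / 4) * q ^ 2) = l * (2 * √π) := by
    rw [integral_const_mul, integral_gaussian]
    congr 1
    rw [show π / (1 / 4) = 2 ^ 2 * π by ring, sqrt_mul (by positivity), sqrt_sq (by norm_num)]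
  rw [← hI]
  have hE : ∀ᶠ b in 𝓝[<] τ, ∫ q, U (c b - √(τ - b) * q) b * exp (-(1 / 4) * q ^ 2)
      = ∫ z, U z b * gaussK (c b - z) (τ - b) := by
    filter_upwards [self_mem_nhdsWithin] with b hb
    have hb : b < τ := hb
    exact (integral_gaussK_eq (fun z => U z b) (c b) (by linarith)).symm
  refine Tendsto.congr' hE ?_
  refine tendsto_integral_filter_of_dominated_convergence
    (fun q => M * exp (-(1 / 4) * q ^ 2)) ?_ ?_ ?_ ?_
  · filter_upwards [hm] with b hb
    exact ((hb.comp (by fun_prop)).mul (by fun_prop)).aestronglyMeasurable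
  · filter_upwards [hb] with b hb
    refine Eventually.of_forall fun q => ?_
    rw [norm_mul, norm_eq_abs, norm_eq_abs, abs_exp]
    gcongr
    exact hb _
  · exact (integrable_exp_neg_mul_sq (by norm_num)).const_mul M
  · refine Eventually.of_forall fun q => ?_
    refine Tendsto.mul_const _ ?_
    have h1 : Tendsto (fun b => c b - √(τ - b) * q) (𝓝[<] τ) (𝓝 z₀) := by
      have h2 : Tendsto (fun b => √(τ - b) * q) (𝓝[<] τ) (𝓝 (√(τ - τ) * q)) :=
        ((by fun_prop : Continuous fun b => √(τ - b) * q).tendsto τ).mono_left nhdsWithin_le_nhds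
      simpa using hc.sub h2
    have h3 : Tendsto (fun b => (c b - √(τ - b) * q, b)) (𝓝[<] τ) (𝓝 (z₀, τ)) :=
      h1.prodMk_nhds (tendsto_id.mono_left nhdsWithin_le_nhds)
    exact hU.comp h3

/-! ### Passing to the singular time and to the boundary -/

section

variable {S L L' M : ℝ} {ζ h v₀ f : ℝ → ℝ} {V W Q : ℝ → ℝ → ℝ}

/-- Extended by zero to `z ≤ 0`, `W` is still jointly continuous at every point off the boundary. A
pole inside the domain therefore recovers `W`, and a pole outside gives zero. -/
theorem IsFlatSolution.tendsto_integral (H : IsFlatSolution S ζ h v₀ V W Q f M)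
    (hζ : IsC1Curve S ζ L) {τ x₀ : ℝ} (hτ : τ ∈ Ioo 0 S) (hx₀ : x₀ - ζ τ ≠ 0) :
    Tendsto (fun b => ∫ z in Ioi (0 : ℝ), W z b * gaussK (x₀ - ζ b - z) (τ - b)) (𝓝[<] τ)
      (𝓝 ((Ioi (0 : ℝ)).indicator (fun z => W z τ) (x₀ - ζ τ) * (2 * √π))) := by
  have hM : 0 ≤ M := (abs_nonneg _).trans (H.bound 1 τ one_pos hτ)
  have hev : ∀ᶠ b in 𝓝[<] τ, b ∈ Ioo 0 S :=
    nhdsWithin_le_nhds (isOpen_Ioo.mem_nhds hτ)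
  have e : ∀ b, ∫ z in Ioi (0 : ℝ), W z b * gaussK (x₀ - ζ b - z) (τ - b)
      = ∫ z, (Ioi (0 : ℝ)).indicator (fun z => W z b) z * gaussK (x₀ - ζ b - z) (τ - b) := by
    intro b
    rw [← integral_indicator measurableSet_Ioi]
    refine integral_congr_ae (Eventually.of_forall fun z => ?_)
    by_cases hz : z ∈ Ioi (0 : ℝ)
    · simp only [indicator_of_mem hz]
    · simp only [indicator_of_notMem hz, zero_mul]
  simp_rw [e]
  refine tendsto_integral_gaussK (U := fun z b => (Ioi (0 : ℝ)).indicator (fun z => W z b) z)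
    (M := M) ?_ ?_ (z₀ := x₀ - ζ τ) ?_ ?_
  · filter_upwards [hev] with b hb
    classical
    rw [← piecewise_eq_indicator]
    exact ContinuousOn.measurable_piecewise (H.continuousOn_slice_z hb).2 continuousOn_const
      measurableSet_Ioi
  · filter_upwards [hev] with b hb z
    by_cases hz : z ∈ Ioi (0 : ℝ)
    · rw [indicator_of_mem hz]; exact H.bound_z z b hz hb
    · rw [indicator_of_notMem hz]; simpa using hM
  · have h1 := (hζ.cont.continuousAt (Icc_mem_nhds hτ.1 hτ.2)).tendsto.mono_left
      (nhdsWithin_le_nhds (s := Iio τ))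
    exact tendsto_const_nhds.sub h1
  · rcases lt_or_gt_of_ne hx₀ with hneg | hpos
    · rw [indicator_of_notMem (show x₀ - ζ τ ∉ Ioi (0 : ℝ) by simpa using hneg.le)]
      refine tendsto_const_nhds.congr' ?_
      have : ∀ᶠ p : ℝ × ℝ in 𝓝 (x₀ - ζ τ, τ), p.1 < 0 :=
        continuousAt_fst.eventually_lt continuousAt_const hneg
      filter_upwards [this] with p hp
      exact (indicator_of_notMem (show p.1 ∉ Ioi (0 : ℝ) by simpa using hp.le) _).symm
    · rw [indicator_of_mem (mem_Ioi.2 hpos)]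
      have h1 := (H.cont_z.continuousAt (x := (x₀ - ζ τ, τ))
        ((isOpen_Ioi.prod isOpen_Ioo).mem_nhds ⟨hpos, hτ⟩)).tendsto
      refine h1.congr' ?_
      have : ∀ᶠ p : ℝ × ℝ in 𝓝 (x₀ - ζ τ, τ), 0 < p.1 :=
        continuousAt_const.eventually_lt continuousAt_fst hpos
      filter_upwards [this] with p hp
      exact (indicator_of_mem (mem_Ioi.2 hp) fun z => W z p.2).symm

theorem tendsto_setIntegral_Ioo_left {φ : ℝ → ℝ} {τ : ℝ} (hτ : 0 < τ)
    (hφ : IntegrableOn φ (Ioo 0 τ)) :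
    Tendsto (fun b => ∫ s in Ioo 0 b, φ s) (𝓝[<] τ) (𝓝 (∫ s in Ioo 0 τ, φ s)) := by
  have h1 : IntegrableOn φ (uIcc 0 τ) := by
    rw [uIcc_of_le hτ.le, integrableOn_Icc_iff_integrableOn_Ioo]; exact hφ
  have h2 := intervalIntegral.continuousOn_primitive_interval h1 τ right_mem_uIcc
  rw [uIcc_of_le hτ.le] at h2
  have h3 : Tendsto (fun b => ∫ s in (0 : ℝ)..b, φ s) (𝓝[<] τ) (𝓝 (∫ s in (0 : ℝ)..τ, φ s)) := by
    refine h2.mono_left ?_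
    rw [← nhdsWithin_Ioo_eq_nhdsLT hτ]
    exact nhdsWithin_mono _ Ioo_subset_Icc_self
  rw [intervalIntegral.integral_of_le hτ.le, integral_Ioc_eq_integral_Ioo] at h3
  refine h3.congr' ?_
  filter_upwards [Ioo_mem_nhdsLT hτ] with b hb
  rw [intervalIntegral.integral_of_le hb.1.le, integral_Ioc_eq_integral_Ioo]

theorem IsC1Curve.continuousOn_sub (hζ : IsC1Curve S ζ L) {τ : ℝ} (hτ : τ ≤ S) (c : ℝ) :
    ContinuousOn (fun s => c - ζ s) (Ioo 0 τ) :=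
  continuousOn_const.sub
    (hζ.cont.mono ((Ioo_subset_Ioo_right hτ).trans Ioo_subset_Icc_self))

/-- The two-sided layer representation of `W` at a distance `η` from the boundary. -/
theorem IsFlatSolution.representation_add (H : IsFlatSolution S ζ h v₀ V W Q f M)
    (hζ : IsC1Curve S ζ L) (hζ0 : ζ 0 = 0) (hh : IsC1Curve S h L')
    (hv₀ : ∀ z, 0 < z → DifferentiableAt ℝ v₀ z)
    (hv₀0 : Tendsto v₀ (𝓝[>] 0) (𝓝 (h 0))) (hv₀i : IntegrableOn (deriv v₀) (Ioi 0))
    {τ η : ℝ} (hτ : τ ∈ Ioo 0 S) (hη : 0 < η) (hη1 : η ≤ 1) :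
    W η τ * (2 * √π) =
      (∫ z in Ioi (0 : ℝ), deriv v₀ z * (gaussK (ζ τ + η - z) τ + gaussK (ζ τ - η - z) τ))
      - (∫ s in Ioo 0 τ, f s * (gaussK₁ (ζ τ - ζ s + η) (τ - s) + gaussK₁ (ζ τ - ζ s - η) (τ - s)))
      - ∫ s in Ioo 0 τ, deriv h s
          * (gaussK (ζ τ - ζ s + η) (τ - s) + gaussK (ζ τ - ζ s - η) (τ - s)) := by
  have hS : 0 < S := hτ.1.trans hτ.2
  have hL := hζ.nonneg hS
  have hL' := hh.nonneg hS
  have hM : 0 ≤ M := (abs_nonneg _).trans (H.bound 1 τ one_pos hτ)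
  have hsub : Ioo 0 τ ⊆ Ioo 0 S := Ioo_subset_Ioo_right hτ.2.le
  have hρ : ContinuousOn (fun s => τ - s) (Ioo 0 τ) := by fun_prop
  have hpos : ∀ s ∈ Ioo 0 τ, 0 < τ - s := fun s hs => by linarith [hs.2]
  have hX : ∀ c : ℝ, ContinuousOn (fun s => ζ τ - ζ s + c) (Ioo 0 τ) := fun c =>
    (hζ.continuousOn_sub hτ.2.le (ζ τ)).add continuousOn_const
  have hX' : ∀ c : ℝ, ContinuousOn (fun s => ζ τ - ζ s - c) (Ioo 0 τ) := fun c =>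
    (hζ.continuousOn_sub hτ.2.le (ζ τ)).sub continuousOn_const
  have i1 : IntegrableOn (fun s => f s * (gaussK₁ (ζ τ - ζ s + η) (τ - s)
      + gaussK₁ (ζ τ - ζ s - η) (τ - s))) (Ioo 0 τ) := by
    refine (intervalIntegrable_iff_integrableOn_Ioo_of_le hτ.1.le).1
      (intervalIntegrable_of_abs_le_div_sqrt (C := M * (L + 2 * L * exp (L / 2))) hτ.1.le ?_ ?_)
    · exact (H.aestronglyMeasurable_flux.mono_measure (Measure.restrict_mono hsub le_rfl)).mul
        (((continuousOn_gaussK₁ (hX η) hρ hpos).add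
          (continuousOn_gaussK₁ (hX' η) hρ hpos)).aestronglyMeasurable measurableSet_Ioo)
    · intro s hs
      rw [abs_mul, mul_div_assoc]
      exact mul_le_mul (H.abs_flux_le (hsub hs)) (abs_gaussK₁_add_gaussK₁_le hL (hpos s hs)
        (hζ.abs_sub_le hs.1.le hs.2 hτ.2.le) hη.le hη1) (abs_nonneg _) hM
  have i2 : IntegrableOn (fun s => deriv h s * (gaussK (ζ τ - ζ s + η) (τ - s)
      + gaussK (ζ τ - ζ s - η) (τ - s))) (Ioo 0 τ) := by
    refine (intervalIntegrable_iff_integrableOn_Ioo_of_le hτ.1.le).1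
      (intervalIntegrable_of_abs_le_div_sqrt (C := L' * 2) hτ.1.le ?_ ?_)
    · exact ((hh.cont_deriv.mono hsub).mul ((continuousOn_gaussK (hX η) hρ hpos).add
          (continuousOn_gaussK (hX' η) hρ hpos))).aestronglyMeasurable measurableSet_Ioo
    · intro s hs
      rw [abs_mul, mul_div_assoc]
      exact mul_le_mul (hh.bound s (hsub hs)) (abs_gaussK_add_gaussK_le _ _) (abs_nonneg _) hL'
  have l1 := H.tendsto_integral hζ (x₀ := ζ τ + η) hτ (by rw [add_sub_cancel_left]; exact hη.ne')
  -- The exterior pole adds nothing on the left; it is there only for the cancellation among the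
  -- layer terms.
  have l2 := H.tendsto_integral hζ (x₀ := ζ τ - η) hτ (by rw [sub_sub_cancel_left]; linarith)
  rw [add_sub_cancel_left, indicator_of_mem (mem_Ioi.2 hη)] at l1
  rw [sub_sub_cancel_left, indicator_of_notMem (by simp [hη.le]), zero_mul] at l2
  have l3 := l1.add l2
  rw [add_zero] at l3
  have r3 := ((tendsto_const_nhds (x := ∫ z in Ioi (0 : ℝ), deriv v₀ z
    * (gaussK (ζ τ + η - z) τ + gaussK (ζ τ - η - z) τ))).sub
    (tendsto_setIntegral_Ioo_left hτ.1 i1)).sub (tendsto_setIntegral_Ioo_left hτ.1 i2)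
  refine tendsto_nhds_unique (l3.congr' ?_) r3
  filter_upwards [Ioo_mem_nhdsLT hτ.1] with b hb
  rw [H.representation hζ hh hv₀ hv₀0 hv₀i _ hb.1 hb.2 hτ.2.le,
    H.representation hζ hh hv₀ hv₀0 hv₀i _ hb.1 hb.2 hτ.2.le, hζ0]
  have e1 : ∀ s, ζ τ + η - ζ s = ζ τ - ζ s + η := fun s => by ring
  have e2 : ∀ s, ζ τ - η - ζ s = ζ τ - ζ s - η := fun s => by ring
  simp_rw [e1, e2, sub_zero, mul_add]
  have hsubb : Icc 0 b ⊆ Icc 0 S := Icc_subset_Icc_right (hb.2.trans hτ.2).le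
  have hsubb' : Ioo 0 b ⊆ Ioo 0 S := Ioo_subset_Ioo_right (hb.2.trans hτ.2).le
  have hrb : ∀ s ∈ Icc 0 b, 0 < τ - s := fun s hs => by linarith [hs.2, hb.2]
  have hζb := hζ.cont.mono hsubb
  have hfb : IntegrableOn f (Ioo 0 b) := integrableOn_Ioo_of_abs_le
    (H.aestronglyMeasurable_flux.mono_measure (Measure.restrict_mono hsubb' le_rfl))
    fun s hs => H.abs_flux_le (hsubb' hs)
  have hhb : IntegrableOn (deriv h) (Ioo 0 b) := integrableOn_Ioo_of_abs_le
    ((hh.cont_deriv.mono hsubb').aestronglyMeasurable measurableSet_Ioo)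
    fun s hs => hh.bound s (hsubb' hs)
  have key : ∀ {φ k : ℝ → ℝ}, IntegrableOn φ (Ioo 0 b) → ContinuousOn k (Icc 0 b) →
      IntegrableOn (fun s => φ s * k s) (Ioo 0 b) := by
    intro φ k hφ hk
    obtain ⟨m, hm⟩ := isCompact_Icc.exists_bound_of_continuousOn hk
    refine Integrable.mul_bdd (c := m) hφ
      ((hk.mono Ioo_subset_Icc_self).aestronglyMeasurable measurableSet_Ioo) ?_
    exact (ae_restrict_mem measurableSet_Ioo).mono fun s hs => hm s (Ioo_subset_Icc_self hs)
  have hXb : ∀ c : ℝ, ContinuousOn (fun s => ζ τ - ζ s + c) (Icc 0 b) := fun c =>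
    (continuousOn_const.sub hζb).add continuousOn_const
  have hXb' : ∀ c : ℝ, ContinuousOn (fun s => ζ τ - ζ s - c) (Icc 0 b) := fun c =>
    (continuousOn_const.sub hζb).sub continuousOn_const
  have hρb : ContinuousOn (fun s => τ - s) (Icc 0 b) := by fun_prop
  rw [integral_add (integrableOn_mul_gaussK hτ.1 hv₀i) (integrableOn_mul_gaussK hτ.1 hv₀i),
    integral_add (key hfb (continuousOn_gaussK₁ (hXb η) hρb hrb))
      (key hfb (continuousOn_gaussK₁ (hXb' η) hρb hrb)),
    integral_add (key hhb (continuousOn_gaussK (hXb η) hρb hrb))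
      (key hhb (continuousOn_gaussK (hXb' η) hρb hrb))]
  ring

/-- The boundary flux satisfies an integral equation. -/
theorem IsFlatSolution.flux_eq (H : IsFlatSolution S ζ h v₀ V W Q f M)
    (hζ : IsC1Curve S ζ L) (hζ0 : ζ 0 = 0) (hh : IsC1Curve S h L')
    (hv₀ : ∀ z, 0 < z → DifferentiableAt ℝ v₀ z)
    (hv₀0 : Tendsto v₀ (𝓝[>] 0) (𝓝 (h 0))) (hv₀i : IntegrableOn (deriv v₀) (Ioi 0))
    {τ : ℝ} (hτ : τ ∈ Ioo 0 S) :
    √π * f τ = (∫ z in Ioi (0 : ℝ), deriv v₀ z * gaussK (ζ τ - z) τ)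
      - (∫ s in Ioo 0 τ, f s * gaussK₁ (ζ τ - ζ s) (τ - s))
      - ∫ s in Ioo 0 τ, deriv h s * gaussK (ζ τ - ζ s) (τ - s) := by
  have hS : 0 < S := hτ.1.trans hτ.2
  have hL := hζ.nonneg hS
  have hL' := hh.nonneg hS
  have hM : 0 ≤ M := (abs_nonneg _).trans (H.bound 1 τ one_pos hτ)
  have hsub : Ioo 0 τ ⊆ Ioo 0 S := Ioo_subset_Ioo_right hτ.2.le
  have hρ : ContinuousOn (fun s => τ - s) (Ioo 0 τ) := by fun_prop
  have hpos : ∀ s ∈ Ioo 0 τ, 0 < τ - s := fun s hs => by linarith [hs.2]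
  have hX : ∀ c : ℝ, ContinuousOn (fun s => ζ τ - ζ s + c) (Ioo 0 τ) := fun c =>
    (hζ.continuousOn_sub hτ.2.le (ζ τ)).add continuousOn_const
  have hX' : ∀ c : ℝ, ContinuousOn (fun s => ζ τ - ζ s - c) (Ioo 0 τ) := fun c =>
    (hζ.continuousOn_sub hτ.2.le (ζ τ)).sub continuousOn_const
  have hη : ∀ᶠ η : ℝ in 𝓝[>] 0, η ∈ Ioc (0 : ℝ) 1 := Ioc_mem_nhdsGT one_pos
  have hsqrt : IntegrableOn (fun s => 1 / √(τ - s)) (Ioo 0 τ) :=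
    (intervalIntegrable_iff_integrableOn_Ioo_of_le hτ.1.le).1
      (intervalIntegrable_one_div_sqrt_sub hτ.1.le)
  have cont : ∀ (c : ℝ) {r : ℝ}, 0 < r →
      Tendsto (fun η => gaussK (c + η) r + gaussK (c - η) r) (𝓝[>] 0) (𝓝 (2 * gaussK c r)) := by
    intro c r hr
    have : Continuous fun η => gaussK (c + η) r + gaussK (c - η) r :=
      (continuousOn_univ.1 <| continuousOn_gaussK (by fun_prop) (by fun_prop) fun _ _ => hr).add
        (continuous_gaussK_sub c hr)
    have h1 := this.tendsto 0
    rw [add_zero, sub_zero, ← two_mul] at h1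
    exact h1.mono_left nhdsWithin_le_nhds
  have cont₁ : ∀ (c : ℝ) {r : ℝ}, 0 < r →
      Tendsto (fun η => gaussK₁ (c + η) r + gaussK₁ (c - η) r) (𝓝[>] 0)
        (𝓝 (2 * gaussK₁ c r)) := by
    intro c r hr
    have : Continuous fun η => gaussK₁ (c + η) r + gaussK₁ (c - η) r :=
      (continuousOn_univ.1 <| continuousOn_gaussK₁ (by fun_prop) (by fun_prop) fun _ _ => hr).add
        (continuous_gaussK₁_sub c hr)
    have h1 := this.tendsto 0
    rw [add_zero, sub_zero, ← two_mul] at h1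
    exact h1.mono_left nhdsWithin_le_nhds
  have t0 : Tendsto (fun η => ∫ z in Ioi (0 : ℝ), deriv v₀ z
      * (gaussK (ζ τ + η - z) τ + gaussK (ζ τ - η - z) τ)) (𝓝[>] 0)
      (𝓝 (∫ z in Ioi (0 : ℝ), deriv v₀ z * (2 * gaussK (ζ τ - z) τ))) := by
    refine tendsto_integral_filter_of_dominated_convergence
      (fun z => |deriv v₀ z| * (2 / √τ)) ?_ ?_ ?_ ?_
    · refine Eventually.of_forall fun η => hv₀i.aestronglyMeasurable.mul ?_
      exact ((continuous_gaussK_sub _ hτ.1).add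
        (continuous_gaussK_sub _ hτ.1)).aestronglyMeasurable
    · refine Eventually.of_forall fun η => Eventually.of_forall fun z => ?_
      rw [norm_mul, norm_eq_abs, norm_eq_abs]
      gcongr
      exact abs_gaussK_add_gaussK_le _ _
    · exact hv₀i.abs.mul_const _
    · refine Eventually.of_forall fun z => Tendsto.const_mul _ ?_
      refine (cont (ζ τ - z) hτ.1).congr fun η => ?_
      congr 2 <;> ring
  -- For the symmetric sum there is a majorant of order `1/√(τ - s)` independent of `η`, so no jump
  -- relation and no continuity of `f` is required.
  have t1 : Tendsto (fun η => ∫ s in Ioo 0 τ, f s * (gaussK₁ (ζ τ - ζ s + η) (τ - s)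
      + gaussK₁ (ζ τ - ζ s - η) (τ - s))) (𝓝[>] 0)
      (𝓝 (∫ s in Ioo 0 τ, f s * (2 * gaussK₁ (ζ τ - ζ s) (τ - s)))) := by
    refine tendsto_integral_filter_of_dominated_convergence
      (fun s => M * (L + 2 * L * exp (L / 2)) * (1 / √(τ - s))) ?_ ?_ ?_ ?_
    · exact Eventually.of_forall fun η =>
        (H.aestronglyMeasurable_flux.mono_measure (Measure.restrict_mono hsub le_rfl)).mul
        (((continuousOn_gaussK₁ (hX η) hρ hpos).add
          (continuousOn_gaussK₁ (hX' η) hρ hpos)).aestronglyMeasurable measurableSet_Ioo)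
    · filter_upwards [hη] with η hη
      refine (ae_restrict_mem measurableSet_Ioo).mono fun s hs => ?_
      rw [norm_mul, norm_eq_abs, norm_eq_abs, mul_assoc, mul_one_div]
      exact mul_le_mul (H.abs_flux_le (hsub hs)) (abs_gaussK₁_add_gaussK₁_le hL (hpos s hs)
        (hζ.abs_sub_le hs.1.le hs.2 hτ.2.le) hη.1.le hη.2) (abs_nonneg _) hM
    · exact hsqrt.const_mul _
    · exact (ae_restrict_mem measurableSet_Ioo).mono fun s hs =>
        (cont₁ (ζ τ - ζ s) (hpos s hs)).const_mul _
  have t2 : Tendsto (fun η => ∫ s in Ioo 0 τ, deriv h s * (gaussK (ζ τ - ζ s + η) (τ - s)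
      + gaussK (ζ τ - ζ s - η) (τ - s))) (𝓝[>] 0)
      (𝓝 (∫ s in Ioo 0 τ, deriv h s * (2 * gaussK (ζ τ - ζ s) (τ - s)))) := by
    refine tendsto_integral_filter_of_dominated_convergence
      (fun s => L' * 2 * (1 / √(τ - s))) ?_ ?_ ?_ ?_
    · exact Eventually.of_forall fun η =>
        ((hh.cont_deriv.mono hsub).mul ((continuousOn_gaussK (hX η) hρ hpos).add
          (continuousOn_gaussK (hX' η) hρ hpos))).aestronglyMeasurable measurableSet_Ioo
    · refine Eventually.of_forall fun η =>
        (ae_restrict_mem measurableSet_Ioo).mono fun s hs => ?_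
      rw [norm_mul, norm_eq_abs, norm_eq_abs, mul_assoc, mul_one_div]
      exact mul_le_mul (hh.bound s (hsub hs)) (abs_gaussK_add_gaussK_le _ _) (abs_nonneg _) hL'
    · exact hsqrt.const_mul _
    · exact (ae_restrict_mem measurableSet_Ioo).mono fun s hs =>
        (cont (ζ τ - ζ s) (hpos s hs)).const_mul _
  have hlim := (t0.sub t1).sub t2
  have hlim' := (H.flux τ hτ).mul_const (2 * √π)
  have hfin := tendsto_nhds_unique (hlim'.congr' ?_) hlim
  · simp_rw [mul_left_comm _ (2 : ℝ)] at hfin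
    rw [integral_const_mul, integral_const_mul, integral_const_mul] at hfin
    linarith
  · filter_upwards [hη] with η hη
    exact H.representation_add hζ hζ0 hh hv₀ hv₀0 hv₀i hτ hη.1 hη.2

end

/-! ### The Volterra kernel and uniqueness -/

/-- This is `y exp(-y) ≤ 1` for `y = x² / (4r)`. It makes the contribution of initial data away from
the corner vanish as `r → 0`. -/
theorem gaussK_le_sqrt_div_sq {x r : ℝ} (hr : 0 < r) (hx : x ≠ 0) :
    gaussK x r ≤ 4 * √r / x ^ 2 := by
  have hx2 : 0 < x ^ 2 := by positivity
  have hq : 0 < √r := by positivity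
  have h5 : x ^ 2 / (4 * r) * exp (-(x ^ 2 / (4 * r))) ≤ 1 := by
    rw [exp_neg, ← div_eq_mul_inv, div_le_one (exp_pos _)]
    linarith [add_one_le_exp (x ^ 2 / (4 * r))]
  have h4 : √r * √r = r := mul_self_sqrt hr.le
  calc gaussK x r = 4 * r / (√r * x ^ 2) * (x ^ 2 / (4 * r) * exp (-(x ^ 2 / (4 * r)))) := by
        unfold gaussK; rw [neg_div]; field_simp
    _ ≤ 4 * r / (√r * x ^ 2) * 1 := by gcongr
    _ = 4 * (√r * √r) / (√r * x ^ 2) := by rw [h4, mul_one]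
    _ = _ := by field_simp

/-- On a Lipschitz curve the increment cancels one power of `r`, which reduces the singularity to
the integrable order `r^(-1/2)`. -/
theorem abs_gaussK₁_le_of_abs_le {L Δ r : ℝ} (hr : 0 < r) (hΔ : |Δ| ≤ L * r) :
    |gaussK₁ Δ r| ≤ L / 2 / √r := by
  have hL : 0 ≤ L := by
    by_contra hneg
    have := (abs_nonneg Δ).trans hΔ
    nlinarith
  unfold gaussK₁
  rw [abs_mul, abs_div, abs_neg, abs_of_pos (show 0 < 2 * r by positivity),
    abs_of_nonneg (gaussK_nonneg _ _)]
  have h1 : |Δ| / (2 * r) ≤ L / 2 := by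
    rw [div_le_iff₀ (by positivity)]; linarith
  calc |Δ| / (2 * r) * gaussK Δ r ≤ L / 2 * (1 / √r) := by
        gcongr
        · exact gaussK_nonneg _ _
        · exact gaussK_le
    _ = _ := by ring

theorem heatKernel_eq (ζ : ℝ → ℝ) (s τ : ℝ) :
    heatKernel ζ s τ = -√π * gaussK₁ (ζ τ - ζ s) (τ - s) := by
  unfold heatKernel gaussK₁ gaussK
  rcases eq_or_ne (τ - s) 0 with h | h
  -- On the diagonal both sides are zero by the convention for division by zero.
  · simp [h]
  · field_simp

section

variable {S L L' M : ℝ} {ζ h v₀ f N : ℝ → ℝ} {V W Q : ℝ → ℝ → ℝ}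

theorem IsC1Curve.abs_heatKernel_le (hζ : IsC1Curve S ζ L) {s τ : ℝ} (hs : 0 ≤ s) (hsτ : s < τ)
    (hτ : τ ≤ S) : |heatKernel ζ s τ| ≤ √π * (L / 2) / √(τ - s) := by
  rw [heatKernel_eq, abs_mul, abs_neg, abs_of_nonneg (sqrt_nonneg _), mul_div_assoc]
  gcongr
  exact abs_gaussK₁_le_of_abs_le (by linarith) (hζ.abs_sub_le hs hsτ hτ)

theorem IsC1Curve.continuousOn_heatKernel (hζ : IsC1Curve S ζ L) {τ : ℝ} (hτ : τ ≤ S) :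
    ContinuousOn (fun s => heatKernel ζ s τ) (Ioo 0 τ) := by
  simp_rw [heatKernel_eq]
  exact continuousOn_const.mul (continuousOn_gaussK₁ (hζ.continuousOn_sub hτ _) (by fun_prop)
    fun s hs => by linarith [hs.2])

theorem IsC1Curve.continuousWithinAt_gaussK (hζ : IsC1Curve S ζ L) {s τ : ℝ} (hsτ : s < τ)
    (hτ : τ ∈ Icc 0 S) :
    ContinuousWithinAt (fun τ => gaussK (ζ τ - ζ s) (τ - s)) (Icc 0 S) τ ∧
    ContinuousWithinAt (fun τ => gaussK₁ (ζ τ - ζ s) (τ - s)) (Icc 0 S) τ := by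
  have hX : ContinuousOn (fun τ => ζ τ - ζ s) (Icc 0 S ∩ Ioi s) :=
    (hζ.cont.mono inter_subset_left).sub continuousOn_const
  have hρ : ContinuousOn (fun τ => τ - s) (Icc 0 S ∩ Ioi s) := by fun_prop
  have hpos : ∀ t ∈ Icc 0 S ∩ Ioi s, 0 < t - s := fun t ht => sub_pos.2 ht.2
  have hmem : Icc 0 S ∩ Ioi s ∈ 𝓝[Icc 0 S] τ :=
    inter_mem self_mem_nhdsWithin (nhdsWithin_le_nhds (Ioi_mem_nhds hsτ))
  exact ⟨(continuousOn_gaussK hX hρ hpos τ ⟨hτ, hsτ⟩).mono_of_mem_nhdsWithin hmem,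
    (continuousOn_gaussK₁ hX hρ hpos τ ⟨hτ, hsτ⟩).mono_of_mem_nhdsWithin hmem⟩

theorem IsC1Curve.intervalIntegrable_heatKernel_mul (hζ : IsC1Curve S ζ L)
    (hfm : AEStronglyMeasurable f (volume.restrict (Ioo 0 S))) (hfb : ∀ s ∈ Ioo 0 S, |f s| ≤ M)
    {τ : ℝ} (hτ : τ ∈ Icc 0 S) :
    IntervalIntegrable (fun s => heatKernel ζ s τ * f s) volume 0 τ := by
  have hsub : Ioo 0 τ ⊆ Ioo 0 S := Ioo_subset_Ioo_right hτ.2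
  refine intervalIntegrable_of_abs_le_div_sqrt (C := √π * (L / 2) * M) hτ.1 ?_ fun s hs => ?_
  · exact ((hζ.continuousOn_heatKernel hτ.2).aestronglyMeasurable measurableSet_Ioo).mul
      (hfm.mono_measure (Measure.restrict_mono hsub le_rfl))
  · rw [abs_mul, mul_div_right_comm]
    have h1 := hζ.abs_heatKernel_le hs.1.le hs.2 hτ.2
    exact mul_le_mul h1 (hfb s (hsub hs)) (abs_nonneg _) ((abs_nonneg _).trans h1)

/-- The smoothing step: a density that is merely bounded and measurable produces a continuous
function, so the equation itself upgrades the flux. -/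
theorem IsC1Curve.continuousOn_integral_heatKernel_mul (hζ : IsC1Curve S ζ L) (hS : 0 < S)
    (hfm : AEStronglyMeasurable f (volume.restrict (Ioo 0 S))) (hfb : ∀ s ∈ Ioo 0 S, |f s| ≤ M) :
    ContinuousOn (fun τ => ∫ s in (0 : ℝ)..τ, heatKernel ζ s τ * f s) (Icc 0 S) := by
  have hM : 0 ≤ M := (abs_nonneg _).trans (hfb (S / 2) ⟨by linarith, by linarith⟩)
  have hL := hζ.nonneg hS
  refine continuousOn_weaklySingular_integral (C := √π * (L / 2) * M) (by positivity)
    (fun τ hτ => ?_) (fun τ hτ s hs => ?_) (fun τ hτ s hs => ?_)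
  · exact ((hζ.continuousOn_heatKernel hτ.2).aestronglyMeasurable measurableSet_Ioo).mul
      (hfm.mono_measure (Measure.restrict_mono (Ioo_subset_Ioo_right hτ.2) le_rfl))
  · rw [abs_mul, mul_div_right_comm]
    have h1 := hζ.abs_heatKernel_le hs.1.le hs.2 hτ.2
    exact mul_le_mul h1 (hfb s ⟨hs.1, hs.2.trans_le hτ.2⟩) (abs_nonneg _)
      ((abs_nonneg _).trans h1)
  · simp_rw [heatKernel_eq]
    exact ((hζ.continuousWithinAt_gaussK hs.2 hτ).2.const_mul _).mul continuousWithinAt_const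

theorem IsC1Curve.continuousOn_integral_gaussK_mul (hζ : IsC1Curve S ζ L) (hh : IsC1Curve S h L')
    (hS : 0 < S) :
    ContinuousOn (fun τ => ∫ s in (0 : ℝ)..τ, gaussK (ζ τ - ζ s) (τ - s) * deriv h s)
      (Icc 0 S) := by
  have hL' := hh.nonneg hS
  refine continuousOn_weaklySingular_integral (C := L') hL'
    (fun τ hτ => ?_) (fun τ hτ s hs => ?_) (fun τ hτ s hs => ?_)
  · exact ((continuousOn_gaussK (hζ.continuousOn_sub hτ.2 _) (by fun_prop)
      fun s hs => by linarith [hs.2]).mul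
      (hh.cont_deriv.mono (Ioo_subset_Ioo_right hτ.2))).aestronglyMeasurable measurableSet_Ioo
  · rw [abs_mul, abs_of_nonneg (gaussK_nonneg _ _), mul_comm, div_eq_mul_one_div]
    exact mul_le_mul (hh.bound s ⟨hs.1, hs.2.trans_le hτ.2⟩) gaussK_le (gaussK_nonneg _ _) hL'
  · exact (hζ.continuousWithinAt_gaussK hs.2 hτ).1.mul continuousWithinAt_const

theorem tendsto_nhdsGT_zero_of_continuousOn {φ : ℝ → ℝ} (hS : 0 < S)
    (hφ : ContinuousOn φ (Icc 0 S)) : Tendsto φ (𝓝[>] 0) (𝓝 (φ 0)) := by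
  refine (hφ 0 ⟨le_rfl, hS.le⟩).mono_left ?_
  rw [← nhdsWithin_Ioc_eq_nhdsGT hS]
  exact nhdsWithin_mono _ Ioc_subset_Icc_self

theorem exists_abs_le_of_continuousOn (hf : ContinuousOn f (Icc 0 S)) :
    ∃ M, (∀ s ∈ Ioo 0 S, |f s| ≤ M) ∧ AEStronglyMeasurable f (volume.restrict (Ioo 0 S)) := by
  obtain ⟨M, hM⟩ := isCompact_Icc.exists_bound_of_continuousOn hf
  exact ⟨M, fun s hs => hM s (Ioo_subset_Icc_self hs),
    (hf.mono Ioo_subset_Icc_self).aestronglyMeasurable measurableSet_Ioo⟩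

/-- The integral equation holds in the limit sense at `τ = 0`. -/
theorem IsVolterraSolution.tendsto_datum (hf : IsVolterraSolution (heatKernel ζ) N S f)
    (hζ : IsC1Curve S ζ L) (hS : 0 < S) : Tendsto N (𝓝[>] 0) (𝓝 (π * f 0)) := by
  obtain ⟨M, hM, hm⟩ := exists_abs_le_of_continuousOn hf.cont
  have h1 := tendsto_nhdsGT_zero_of_continuousOn hS
    (hζ.continuousOn_integral_heatKernel_mul hS hm hM)
  have h2 := (tendsto_nhdsGT_zero_of_continuousOn hS hf.cont).const_mul π
  have h3 := h2.sub h1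
  rw [intervalIntegral.integral_same, sub_zero] at h3
  refine h3.congr' ?_
  filter_upwards [Ioc_mem_nhdsGT hS] with τ hτ
  rw [hf.eqn τ hτ]; ring

/-- The equation is imposed only for `τ > 0`; at `0` both solutions are determined by the limit of
the datum. Their difference solves the homogeneous equation, to which the Gronwall lemma applies. -/
theorem IsVolterraSolution.eqOn {f' : ℝ → ℝ} (hf : IsVolterraSolution (heatKernel ζ) N S f)
    (hf' : IsVolterraSolution (heatKernel ζ) N S f') (hζ : IsC1Curve S ζ L) (hS : 0 < S) :
    EqOn f f' (Icc 0 S) := by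
  have h0 : f 0 = f' 0 := mul_left_cancel₀ pi_ne_zero
    (tendsto_nhds_unique (hf.tendsto_datum hζ hS) (hf'.tendsto_datum hζ hS))
  have hL := hζ.nonneg hS
  have hd : ContinuousOn (fun s => f s - f' s) (Icc 0 S) := hf.cont.sub hf'.cont
  have key := eqOn_zero_of_abs_le_weaklySingular_integral (C := √π * (L / 2) / π)
    (by positivity) hd ?_
  · intro τ hτ
    have := key hτ
    simpa [sub_eq_zero] using this
  · intro τ hτ
    rcases hτ.1.eq_or_lt with h | h
    · rw [← h]; simp [h0]
    · have hτ' : τ ∈ Ioc 0 S := ⟨h, hτ.2⟩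
      have e : f τ - f' τ = (∫ s in (0 : ℝ)..τ, heatKernel ζ s τ * (f s - f' s)) / π := by
        have e1 := hf.eqn τ hτ'
        have e2 := hf'.eqn τ hτ'
        simp_rw [mul_sub]
        rw [intervalIntegral.integral_sub (hf.integrable τ hτ') (hf'.integrable τ hτ'),
          eq_div_iff pi_ne_zero]
        linarith
      rw [e, abs_div, abs_of_pos pi_pos, div_mul_eq_mul_div]
      gcongr
      rw [← intervalIntegral.integral_const_mul, ← norm_eq_abs]
      refine intervalIntegral.norm_integral_le_of_norm_le hτ.1 ?_ ?_
      · have : ∀ᵐ s : ℝ ∂volume, s ≠ τ := by simp [ae_iff]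
        filter_upwards [this] with s hsτ hs
        have hs' : s < τ := lt_of_le_of_ne hs.2 hsτ
        rw [norm_mul, norm_eq_abs, norm_eq_abs, ← mul_assoc, mul_one_div]
        gcongr
        exact hζ.abs_heatKernel_le hs.1.le hs' hτ.2
      · refine (IntervalIntegrable.mul_continuousOn (intervalIntegrable_one_div_sqrt_sub hτ.1)
          ?_).const_mul _
        rw [uIcc_of_le hτ.1]
        exact (hd.mono (Icc_subset_Icc_right hτ.2)).abs

end

/-! ### The initial datum near time zero and existence of a continuous solution -/

section

variable {S L L' M l : ℝ} {ζ h v₀ f : ℝ → ℝ} {V W Q : ℝ → ℝ → ℝ}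

theorem IsC1Curve.continuousOn_integral_initial (hζ : IsC1Curve S ζ L) {w : ℝ → ℝ}
    (hw : IntegrableOn w (Ioi 0)) :
    ContinuousOn (fun τ => ∫ z in Ioi (0 : ℝ), w z * gaussK (ζ τ - z) τ) (Ioc 0 S) := by
  intro τ₀ hτ₀
  have hev : ∀ᶠ τ in 𝓝[Ioc 0 S] τ₀, τ₀ / 2 < τ :=
    nhdsWithin_le_nhds (Ioi_mem_nhds (by linarith [hτ₀.1]))
  refine continuousWithinAt_of_dominated (bound := fun z => |w z| * (1 / √(τ₀ / 2))) ?_ ?_ ?_ ?_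
  · filter_upwards [self_mem_nhdsWithin] with τ hτ
    exact (integrableOn_mul_gaussK hτ.1 hw).aestronglyMeasurable
  · filter_upwards [hev] with τ hτ
    refine Eventually.of_forall fun z => ?_
    rw [norm_mul, norm_eq_abs, norm_eq_abs, abs_of_nonneg (gaussK_nonneg _ _)]
    have : 0 < τ₀ / 2 := by linarith [hτ₀.1]
    have h2 : 1 / √τ ≤ 1 / √(τ₀ / 2) := by gcongr
    gcongr
    exact gaussK_le.trans h2
  · exact hw.abs.mul_const _
  · refine Eventually.of_forall fun z => continuousWithinAt_const.mul ?_
    exact continuousOn_gaussK ((hζ.cont.mono Ioc_subset_Icc_self).sub continuousOn_const)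
      continuousOn_id (fun τ hτ => hτ.1) τ₀ hτ₀

/-- At the starting point of the curve only half of the mass of the heat kernel is seen. -/
theorem IsC1Curve.tendsto_integral_initial (hζ : IsC1Curve S ζ L) (hζ0 : ζ 0 = 0) (hS : 0 < S)
    {w : ℝ → ℝ} (hwm : Measurable w) (hw : IntegrableOn w (Ioi 0))
    (hl : Tendsto w (𝓝[>] 0) (𝓝 l)) :
    Tendsto (fun τ => ∫ z in Ioi (0 : ℝ), w z * gaussK (ζ τ - z) τ) (𝓝[>] 0) (𝓝 (√π * l)) := by
  have hL := hζ.nonneg hS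
  have hζle : ∀ᶠ τ in 𝓝[>] (0 : ℝ), |ζ τ| ≤ L * τ := by
    filter_upwards [Ioc_mem_nhdsGT hS] with τ hτ
    simpa [hζ0] using hζ.abs_sub_le le_rfl hτ.1 hτ.2
  -- The data `w` is integrable but need not be bounded, so it is split: near `0` it is bounded by
  -- its limit there, and beyond `δ` only its integral is used.
  obtain ⟨δ, hδ, hδb⟩ : ∃ δ : ℝ, 0 < δ ∧ ∀ z ∈ Ioc 0 δ, |w z| ≤ |l| + 1 := by
    have h1 : ∀ᶠ z in 𝓝[>] (0 : ℝ), |w z| < |l| + 1 :=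
      hl.abs.eventually_lt_const (by linarith)
    obtain ⟨δ, hδ, h⟩ := (mem_nhdsGT_iff_exists_Ioc_subset).1 h1
    exact ⟨δ, hδ, fun z hz => (h hz).le⟩
  have hsplit : ∀ᶠ τ in 𝓝[>] (0 : ℝ), (∫ z in Ioc 0 δ, w z * gaussK (ζ τ - z) τ)
      + (∫ z in Ioi δ, w z * gaussK (ζ τ - z) τ)
      = ∫ z in Ioi (0 : ℝ), w z * gaussK (ζ τ - z) τ := by
    filter_upwards [self_mem_nhdsWithin] with τ hτ
    have hi := integrableOn_mul_gaussK (c := ζ τ) hτ hw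
    rw [← Ioc_union_Ioi_eq_Ioi hδ.le, setIntegral_union Ioc_disjoint_Ioi_same measurableSet_Ioi
      (hi.mono_set Ioc_subset_Ioi_self) (hi.mono_set (Ioi_subset_Ioi hδ.le))]
  have hζlim : Tendsto ζ (𝓝[>] 0) (𝓝 0) := by
    simpa [hζ0] using tendsto_nhdsGT_zero_of_continuousOn hS hζ.cont
  have hfar : Tendsto (fun τ => ∫ z in Ioi δ, w z * gaussK (ζ τ - z) τ) (𝓝[>] 0) (𝓝 0) := by
    have hlim : Tendsto (fun τ : ℝ => 4 * √τ / (δ / 2) ^ 2 * ∫ z in Ioi δ, |w z|) (𝓝[>] 0)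
        (𝓝 0) := by
      have : Continuous fun τ : ℝ => 4 * √τ / (δ / 2) ^ 2 * ∫ z in Ioi δ, |w z| := by fun_prop
      have h1 := this.tendsto 0
      simp only [sqrt_zero, mul_zero, zero_div, zero_mul] at h1
      exact h1.mono_left nhdsWithin_le_nhds
    refine squeeze_zero_norm' ?_ hlim
    filter_upwards [self_mem_nhdsWithin, hζlim.eventually_lt_const (half_pos hδ)] with τ hτ hτ2
    have hτ : 0 < τ := hτ
    rw [← integral_const_mul]
    refine norm_integral_le_of_norm_le ((hw.mono_set (Ioi_subset_Ioi hδ.le)).abs.const_mul _) ?_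
    refine (ae_restrict_mem measurableSet_Ioi).mono fun z hz => ?_
    have hz : δ < z := hz
    rw [norm_mul, norm_eq_abs, norm_eq_abs, abs_of_nonneg (gaussK_nonneg _ _), mul_comm]
    gcongr
    refine (gaussK_le_sqrt_div_sq hτ (by linarith)).trans ?_
    gcongr 4 * √τ / ?_
    nlinarith
  have hnear : Tendsto (fun τ => ∫ z in Ioc 0 δ, w z * gaussK (ζ τ - z) τ) (𝓝[>] 0)
      (𝓝 (√π * l)) := by
    set U : ℝ → ℝ := (Ioc 0 δ).indicator w with hU
    have hUm : Measurable U := hwm.indicator measurableSet_Ioc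
    have hUb : ∀ z, |U z| ≤ |l| + 1 := by
      intro z
      by_cases hz : z ∈ Ioc 0 δ
      · rw [hU, indicator_of_mem hz]; exact hδb z hz
      · rw [hU, indicator_of_notMem hz, abs_zero]; positivity
    have hE : ∀ᶠ τ in 𝓝[>] (0 : ℝ), ∫ q, U (ζ τ + √τ * q) * exp (-(1 / 4) * q ^ 2)
        = ∫ z in Ioc 0 δ, w z * gaussK (ζ τ - z) τ := by
      filter_upwards [self_mem_nhdsWithin] with τ hτ
      have e1 : ∫ z in Ioc 0 δ, w z * gaussK (ζ τ - z) τ = ∫ z, U z * gaussK (ζ τ - z) τ := by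
        rw [← integral_indicator measurableSet_Ioc]
        refine integral_congr_ae (Eventually.of_forall fun z => ?_)
        exact indicator_mul_left (Ioc 0 δ) w fun z => gaussK (ζ τ - z) τ
      rw [e1, integral_gaussK_eq U (ζ τ) hτ,
        ← integral_neg_eq_self fun q => U (ζ τ - √τ * q) * exp (-(1 / 4) * q ^ 2)]
      simp
    have hI : ∫ q : ℝ, (Ioi (0 : ℝ)).indicator (fun q => l * exp (-(1 / 4) * q ^ 2)) q
        = √π * l := by
      rw [integral_indicator measurableSet_Ioi, integral_const_mul, integral_gaussian_Ioi,
        show π / (1 / 4) = 2 ^ 2 * π by ring, sqrt_mul (by positivity), sqrt_sq (by norm_num)]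
      ring
    rw [← hI]
    refine Tendsto.congr' hE ?_
    refine tendsto_integral_filter_of_dominated_convergence
      (fun q => (|l| + 1) * exp (-(1 / 4) * q ^ 2)) ?_ ?_ ?_ ?_
    · exact Eventually.of_forall fun τ =>
        ((hUm.comp (by fun_prop)).mul (by fun_prop)).aestronglyMeasurable
    · refine Eventually.of_forall fun τ => Eventually.of_forall fun q => ?_
      rw [norm_mul, norm_eq_abs, norm_eq_abs, abs_exp]
      gcongr
      exact hUb _
    · exact (integrable_exp_neg_mul_sq (by norm_num)).const_mul _
    · have : ∀ᵐ q : ℝ ∂volume, q ≠ 0 := by simp [ae_iff]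
      filter_upwards [this] with q hq
      have hsm : ∀ᶠ τ in 𝓝[>] (0 : ℝ), L * √τ < |q| := by
        have h1 : Tendsto (fun τ : ℝ => L * √τ) (𝓝 0) (𝓝 (L * √0)) :=
          (by fun_prop : Continuous fun τ : ℝ => L * √τ).tendsto 0
        rw [sqrt_zero, mul_zero] at h1
        exact (h1.mono_left nhdsWithin_le_nhds).eventually_lt_const (abs_pos.2 hq)
      -- The curve moves by `O(τ)` and diffusion by `√τ`. Hence `ζ(τ) + √τ q` eventually has the
      -- sign of `q`, and in the limit exactly the half-line `q > 0` contributes.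
      have hbd : ∀ᶠ τ in 𝓝[>] (0 : ℝ), |ζ τ| < √τ * |q| := by
        filter_upwards [hζle, hsm, self_mem_nhdsWithin] with τ h1 h2 h3
        have h3 : 0 < τ := h3
        have h4 : √τ * √τ = τ := mul_self_sqrt h3.le
        have h5 : 0 < √τ := by positivity
        calc |ζ τ| ≤ L * τ := h1
          _ = √τ * (L * √τ) := by rw [← h4]; simp; ring
          _ < _ := by gcongr
      rcases lt_or_gt_of_ne hq with h | h
      · rw [indicator_of_notMem (show q ∉ Ioi (0 : ℝ) by simpa using h.le)]
        refine tendsto_const_nhds.congr' ?_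
        filter_upwards [hbd] with τ hτ
        rw [abs_of_neg h] at hτ
        have : ζ τ + √τ * q < 0 := by linarith [le_abs_self (ζ τ)]
        rw [hU, indicator_of_notMem (fun hh => by linarith [hh.1]), zero_mul]
      · rw [indicator_of_mem (mem_Ioi.2 h)]
        refine Tendsto.mul_const _ ?_
        have hgt : ∀ᶠ τ in 𝓝[>] (0 : ℝ), ζ τ + √τ * q ∈ Ioi (0 : ℝ) := by
          filter_upwards [hbd] with τ hτ
          rw [abs_of_pos h] at hτ
          have := neg_abs_le (ζ τ)
          simp only [mem_Ioi]; linarith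
        have harg : Tendsto (fun τ => ζ τ + √τ * q) (𝓝[>] 0) (𝓝 0) := by
          have h2 : Tendsto (fun τ : ℝ => √τ * q) (𝓝 0) (𝓝 (√0 * q)) :=
            (by fun_prop : Continuous fun τ : ℝ => √τ * q).tendsto 0
          rw [sqrt_zero, zero_mul] at h2
          simpa using hζlim.add (h2.mono_left nhdsWithin_le_nhds)
        have harg' := tendsto_nhdsWithin_iff.2 ⟨harg, hgt⟩
        refine (hl.comp harg').congr' ?_
        filter_upwards [hgt, harg.eventually_lt_const hδ] with τ h1 h2
        rw [hU, indicator_of_mem (show ζ τ + √τ * q ∈ Ioc 0 δ from ⟨h1, h2.le⟩)]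
        rfl
  have := hnear.add hfar
  rw [add_zero] at this
  exact this.congr' hsplit

/-- The data term of the integral equation for the flux through the curve `ζ`. -/
def fluxDatum (ζ v₀ h : ℝ → ℝ) (τ : ℝ) : ℝ :=
  √π * (1 / √τ * (∫ x in Ioi (0 : ℝ), exp (-(ζ τ - x) ^ 2 / (4 * τ)) * deriv v₀ x)
    - ∫ s in (0 : ℝ)..τ, exp (-(ζ τ - ζ s) ^ 2 / (4 * (τ - s))) / √(τ - s) * deriv h s)

theorem fluxDatum_eq (ζ v₀ h : ℝ → ℝ) (τ : ℝ) :
    fluxDatum ζ v₀ h τ = √π * ((∫ z in Ioi (0 : ℝ), deriv v₀ z * gaussK (ζ τ - z) τ)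
      - ∫ s in (0 : ℝ)..τ, gaussK (ζ τ - ζ s) (τ - s) * deriv h s) := by
  have e : ∀ x, 1 / √τ * (exp (-(ζ τ - x) ^ 2 / (4 * τ)) * deriv v₀ x)
      = deriv v₀ x * gaussK (ζ τ - x) τ := fun x => by unfold gaussK; ring
  rw [fluxDatum, ← integral_const_mul]
  simp_rw [e]
  rfl

/-- The values of `f` at `0` and `S` are not controlled, so the solution is built from the
right-hand side of the equation, which agrees with `f` inside the interval and is continuous up to
both ends. -/
theorem IsFlatSolution.exists_volterraSolution (H : IsFlatSolution S ζ h v₀ V W Q f M) (hS : 0 < S)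
    (hζ : IsC1Curve S ζ L) (hζ0 : ζ 0 = 0) (hh : IsC1Curve S h L')
    (hv₀ : ∀ z, 0 < z → DifferentiableAt ℝ v₀ z)
    (hv₀0 : Tendsto v₀ (𝓝[>] 0) (𝓝 (h 0))) (hv₀i : IntegrableOn (deriv v₀) (Ioi 0))
    (hl : Tendsto (deriv v₀) (𝓝[>] 0) (𝓝 l)) :
    ∃ F : ℝ → ℝ, IsVolterraSolution (heatKernel ζ) (fluxDatum ζ v₀ h) S F ∧
      ∀ τ ∈ Ioo 0 S, F τ = f τ := by
  have hfm := H.aestronglyMeasurable_flux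
  have hfb : ∀ s ∈ Ioo 0 S, |f s| ≤ M := fun s hs => H.abs_flux_le hs
  set P : ℝ → ℝ := fun τ => ∫ s in (0 : ℝ)..τ, heatKernel ζ s τ * f s with hP
  set N := fluxDatum ζ v₀ h with hN
  have hPc : ContinuousOn P (Icc 0 S) := hζ.continuousOn_integral_heatKernel_mul hS hfm hfb
  have hGc := hζ.continuousOn_integral_gaussK_mul hh hS
  have hNc : ContinuousOn N (Ioc 0 S) := by
    rw [hN, show fluxDatum ζ v₀ h = _ from funext (fluxDatum_eq ζ v₀ h)]
    exact ((hζ.continuousOn_integral_initial hv₀i).sub (hGc.mono Ioc_subset_Icc_self)).const_mul _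
  have hN0 : Tendsto N (𝓝[>] 0) (𝓝 (π * l)) := by
    rw [hN, show fluxDatum ζ v₀ h = _ from funext (fluxDatum_eq ζ v₀ h)]
    have h1 := ((hζ.tendsto_integral_initial hζ0 hS (measurable_deriv v₀) hv₀i hl).sub
      (tendsto_nhdsGT_zero_of_continuousOn hS hGc)).const_mul √π
    rw [intervalIntegral.integral_same, sub_zero, ← mul_assoc, mul_self_sqrt pi_pos.le] at h1
    exact h1
  have hP0 : Tendsto P (𝓝[>] 0) (𝓝 0) := by
    have := tendsto_nhdsGT_zero_of_continuousOn hS hPc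
    simpa [hP] using this
  -- The value at `0` is the limit of the quotient: there the datum tends to `π l` and the integral
  -- to zero.
  set F : ℝ → ℝ := Function.update (fun τ => (N τ + P τ) / π) 0 l with hF
  have hF1 : ∀ τ, 0 < τ → F τ = (N τ + P τ) / π := fun τ hτ => by
    rw [hF, Function.update_of_ne hτ.ne']
  have hFf : ∀ τ ∈ Ioo 0 S, F τ = f τ := by
    intro τ hτ
    rw [hF1 τ hτ.1, div_eq_iff pi_ne_zero]
    have h1 := H.flux_eq hζ hζ0 hh hv₀ hv₀0 hv₀i hτ
    have h2 : π * f τ = √π * (√π * f τ) := by rw [← mul_assoc, mul_self_sqrt pi_pos.le]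
    have e1 : P τ = -√π * ∫ s in Ioo 0 τ, f s * gaussK₁ (ζ τ - ζ s) (τ - s) := by
      rw [hP]
      simp only [heatKernel_eq]
      rw [intervalIntegral.integral_of_le hτ.1.le, integral_Ioc_eq_integral_Ioo,
        ← integral_const_mul]
      refine integral_congr_ae (Eventually.of_forall fun s => ?_)
      simp only
      ring
    have e2 : ∫ s in (0 : ℝ)..τ, gaussK (ζ τ - ζ s) (τ - s) * deriv h s
        = ∫ s in Ioo 0 τ, deriv h s * gaussK (ζ τ - ζ s) (τ - s) := by
      rw [intervalIntegral.integral_of_le hτ.1.le, integral_Ioc_eq_integral_Ioo]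
      refine integral_congr_ae (Eventually.of_forall fun s => mul_comm _ _)
    rw [mul_comm, h2, h1, hN, fluxDatum_eq, e1, e2]
    ring
  -- The integral only sees `f` on the open interval, so replacing it by `F` is harmless even at `τ
  -- = S`.
  have hae : ∀ τ ∈ Ioc 0 S, ∀ s ∈ Ioo 0 τ, heatKernel ζ s τ * f s = heatKernel ζ s τ * F s := by
    intro τ hτ s hs
    rw [hFf s ⟨hs.1, hs.2.trans_le hτ.2⟩]
  refine ⟨F, ⟨?_, ?_, ?_⟩, hFf⟩
  · rw [hF, continuousOn_update_iff, Icc_sdiff_left]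
    refine ⟨(hNc.add (hPc.mono Ioc_subset_Icc_self)).div_const _, fun _ => ?_⟩
    rw [nhdsWithin_Ioc_eq_nhdsGT hS]
    have := (hN0.add hP0).div_const π
    rwa [add_zero, mul_div_cancel_left₀ _ pi_ne_zero] at this
  · intro τ hτ
    have h1 := hζ.intervalIntegrable_heatKernel_mul hfm hfb ⟨hτ.1.le, hτ.2⟩
    rw [intervalIntegrable_iff_integrableOn_Ioo_of_le hτ.1.le] at h1 ⊢
    exact h1.congr_fun (hae τ hτ) measurableSet_Ioo
  · intro τ hτ
    rw [hF1 τ hτ.1, mul_div_cancel₀ _ pi_ne_zero, hP]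
    simp only
    rw [intervalIntegral.integral_of_le hτ.1.le, intervalIntegral.integral_of_le hτ.1.le,
      integral_Ioc_eq_integral_Ioo, integral_Ioc_eq_integral_Ioo,
      setIntegral_congr_fun measurableSet_Ioo (hae τ hτ)]

end

/-! ### From the forward problem to the straightened one -/

theorem ContDiffOn.exists_isC1Curve {S : ℝ} {φ : ℝ → ℝ} (hφ : ContDiffOn ℝ 1 φ (Icc 0 S))
    (hS : 0 < S) : ∃ L, IsC1Curve S φ L := by
  have h1 := hφ.continuousOn_derivWithin (uniqueDiffOn_Icc hS) le_rfl
  have h2 : ∀ s ∈ Ioo 0 S, derivWithin φ (Icc 0 S) s = deriv φ s := fun s hs =>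
    derivWithin_of_mem_nhds (Icc_mem_nhds hs.1 hs.2)
  obtain ⟨L, hL⟩ := isCompact_Icc.exists_bound_of_continuousOn h1
  refine ⟨L, hφ.continuousOn, fun s hs => ?_, ?_, fun s hs => ?_⟩
  · exact (hφ.differentiableOn one_ne_zero s (Ioo_subset_Icc_self hs)).differentiableAt
      (Icc_mem_nhds hs.1 hs.2)
  · exact (h1.mono Ioo_subset_Icc_self).congr fun s hs => (h2 s hs).symm
  · rw [← h2 s hs]; exact hL s (Ioo_subset_Icc_self hs)

theorem div_mem_Icc_of_mem {γ T s : ℝ} (hγ : 0 < γ) (hs : s ∈ Icc 0 (γ * T)) :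
    s / γ ∈ Icc 0 T :=
  ⟨div_nonneg hs.1 hγ.le, by rw [div_le_iff₀ hγ]; linarith [hs.2]⟩

theorem div_mem_Ioo_of_mem {γ T s : ℝ} (hγ : 0 < γ) (hs : s ∈ Ioo 0 (γ * T)) :
    s / γ ∈ Ioo 0 T :=
  ⟨div_pos hs.1 hγ, by rw [div_lt_iff₀ hγ]; linarith [hs.2]⟩

theorem ContDiffOn.comp_div_const {T γ : ℝ} {φ : ℝ → ℝ} (hφ : ContDiffOn ℝ 1 φ (Icc 0 T))
    (hγ : 0 < γ) : ContDiffOn ℝ 1 (fun s => φ (s / γ)) (Icc 0 (γ * T)) :=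
  hφ.comp (f := fun s => s / γ) (by fun_prop) fun _ hs => div_mem_Icc_of_mem hγ hs

theorem isOpen_rightRegion {ξ : ℝ → ℝ} {T : ℝ} (hξ : ContinuousOn ξ (Icc 0 T)) :
    IsOpen (rightRegion ξ T) := by
  rw [isOpen_iff_mem_nhds]
  rintro ⟨x, t⟩ ⟨ht, hx⟩
  have h1 : ContinuousAt (fun p : ℝ × ℝ => ξ p.2) (x, t) :=
    ContinuousAt.comp (f := Prod.snd) (hξ.continuousAt (Icc_mem_nhds ht.1 ht.2)) continuousAt_snd
  have h2 : ∀ᶠ p : ℝ × ℝ in 𝓝 (x, t), p.2 ∈ Ioo 0 T :=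
    continuousAt_snd.eventually (isOpen_Ioo.mem_nhds ht)
  filter_upwards [h2, h1.eventually_lt continuousAt_fst hx] with p hp1 hp2 using ⟨hp1, hp2⟩

theorem mem_closure_rightRegion {ξ : ℝ → ℝ} {T x t : ℝ} (hT : 0 < T)
    (hξ : ContinuousOn ξ (Icc 0 T)) (ht : t ∈ Icc 0 T) (hx : ξ t ≤ x) :
    (x, t) ∈ closure (rightRegion ξ T) := by
  -- Pulling the time towards `T / 2` makes it interior even when `t` is `0` or `T`; an extra offset
  -- `ε` in space keeps the point strictly to the right of the curve.
  set c : ℝ → ℝ := fun ε => (1 - ε) * t + ε * (T / 2) with hc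
  have hc0 : ∀ ε ∈ Ioo (0 : ℝ) 1, c ε ∈ Ioo 0 T := by
    intro ε hε
    have h1 : 0 ≤ (1 - ε) * t := mul_nonneg (by linarith [hε.2]) ht.1
    have h2 : (1 - ε) * t ≤ (1 - ε) * T := mul_le_mul_of_nonneg_left ht.2 (by linarith [hε.2])
    have h3 : 0 < ε * T := mul_pos hε.1 hT
    constructor <;> simp only [hc] <;> nlinarith
  have hev : ∀ᶠ ε in 𝓝[>] (0 : ℝ), ε ∈ Ioo (0 : ℝ) 1 := Ioo_mem_nhdsGT one_pos
  have hct : Tendsto c (𝓝[>] 0) (𝓝 t) := by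
    have := (by fun_prop : Continuous c).tendsto 0
    simp only [hc, sub_zero, one_mul, zero_mul, add_zero] at this
    exact this.mono_left nhdsWithin_le_nhds
  have hξt : Tendsto (fun ε => ξ (c ε)) (𝓝[>] 0) (𝓝 (ξ t)) :=
    (hξ t ht).tendsto.comp (tendsto_nhdsWithin_iff.2 ⟨hct, by
      filter_upwards [hev] with ε hε using Ioo_subset_Icc_self (hc0 ε hε)⟩)
  have hid : Tendsto (fun ε : ℝ => ε) (𝓝[>] 0) (𝓝 0) := nhdsWithin_le_nhds
  have hlim : Tendsto (fun ε => (ξ (c ε) + (x - ξ t) + ε, c ε)) (𝓝[>] 0) (𝓝 (x, t)) := by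
    have h1 := (hξt.add_const (x - ξ t)).add hid
    rw [add_zero, add_sub_cancel] at h1
    exact h1.prodMk_nhds hct
  refine mem_closure_of_tendsto hlim ?_
  filter_upwards [hev] with ε hε
  exact ⟨hc0 ε hε, by simp only; linarith [hε.1]⟩

/-- The regularity class speaks of partial derivatives only. Their continuity on an open set gives
joint strict differentiability, hence the chain rule along a moving point. -/
theorem IsC21On.hasDerivAt_comp {u : ℝ → ℝ → ℝ} {A : Set (ℝ × ℝ)} (hu : IsC21On u A)
    (hA : IsOpen A) {X Y : ℝ → ℝ} {X' Y' s : ℝ} (hX : HasDerivAt X X' s) (hY : HasDerivAt Y Y' s)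
    (hs : (X s, Y s) ∈ A) :
    HasDerivAt (fun s => u (X s) (Y s))
      (X' * partialX u (X s) (Y s) + Y' * partialT u (X s) (Y s)) s := by
  have hev : ∀ᶠ p in 𝓝 (X s, Y s), p ∈ A := hA.mem_nhds hs
  have h := hasStrictFDerivAt_uncurry_coprod (𝕜 := ℝ) (u := (X s, Y s)) (f := u)
    (f₁ := fun x t => partialX u x t • ContinuousLinearMap.id ℝ ℝ)
    (f₂ := fun x t => partialT u x t • ContinuousLinearMap.id ℝ ℝ) ?_ ?_ ?_ ?_
  · have h1 := h.hasFDerivAt.comp_hasDerivAt s (hX.prodMk hY)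
    refine h1.congr_deriv ?_
    simp [Function.HasUncurry.uncurry, mul_comm]
  · filter_upwards [hev] with p hp
    exact (hu.diff_x p hp).hasDerivAt.hasFDerivAt.congr_fderiv (by
      ext; simp [Function.HasUncurry.uncurry, partialX])
  · filter_upwards [hev] with p hp
    exact (hu.diff_t p hp).hasDerivAt.hasFDerivAt.congr_fderiv (by
      ext; simp [Function.HasUncurry.uncurry, partialT])
  · exact (hu.cont_x.continuousAt hev).smul continuousAt_const
  · exact (hu.cont_t.continuousAt hev).smul continuousAt_const

/-- A regular solution to the right of the interface, in the coordinates attached to it. -/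
theorem SolvesForward.exists_isFlatSolution {γ T : ℝ} {ξ u₀ g : ℝ → ℝ} {u : ℝ → ℝ → ℝ}
    (hu : SolvesForward γ ξ T u₀ g u) (hγ : 0 < γ) (hT : 0 < T)
    (hξ : ContDiffOn ℝ 1 ξ (Icc 0 T)) (hξ0 : ξ 0 = 0) :
    ∃ f M, IsFlatSolution (γ * T) (curve₂ ξ γ) (fun s => g (s / γ)) u₀
      (fun z s => u (ξ (s / γ) + z) (s / γ)) (fun z s => partialX u (ξ (s / γ) + z) (s / γ))
      (fun z s => partialXX u (ξ (s / γ) + z) (s / γ)) f M := by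
  have hξc := hξ.continuousOn
  have hopen := isOpen_rightRegion hξc
  have hmem : ∀ z s, 0 < z → s ∈ Ioo 0 (γ * T) →
      (ξ (s / γ) + z, s / γ) ∈ rightRegion ξ T := fun z s hz hs =>
    ⟨div_mem_Ioo_of_mem hγ hs, by simp only; linarith⟩
  have hmap : ContinuousOn (fun p : ℝ × ℝ => (ξ (p.2 / γ) + p.1, p.2 / γ))
      (Ioi 0 ×ˢ Ioo 0 (γ * T)) := by
    have h1 : ContinuousOn (fun p : ℝ × ℝ => ξ (p.2 / γ)) (Ioi 0 ×ˢ Ioo 0 (γ * T)) :=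
      hξc.comp (f := fun p : ℝ × ℝ => p.2 / γ) (by fun_prop)
        fun p hp => Ioo_subset_Icc_self (div_mem_Ioo_of_mem hγ hp.2)
    exact (h1.add continuousOn_fst).prodMk (by fun_prop)
  have hmaps : MapsTo (fun p : ℝ × ℝ => (ξ (p.2 / γ) + p.1, p.2 / γ))
      (Ioi 0 ×ˢ Ioo 0 (γ * T)) (rightRegion ξ T) := fun p hp => hmem p.1 p.2 hp.1 hp.2
  obtain ⟨M₁, hM₁⟩ := hu.regular.bounded
  obtain ⟨M₂, hM₂⟩ := hu.regular.bounded_x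
  choose! f hf using hu.trace
  have hc21 := hu.regular.c21
  refine ⟨fun s => f (s / γ), max M₁ M₂, ?_, ?_, ?_, ?_, ?_, ?_, ?_, ?_, ?_, ?_, ?_⟩
  · intro z s hz hs
    exact HasDerivAt.comp_const_add (f := fun y => u y (s / γ)) (ξ (s / γ)) z
      (hc21.diff_x _ (hmem z s hz hs)).hasDerivAt
  · intro z s hz hs
    exact HasDerivAt.comp_const_add (f := fun y => partialX u y (s / γ)) (ξ (s / γ)) z
      (hc21.diff_xx _ (hmem z s hz hs)).hasDerivAt
  · intro z s hz hs
    have hd : DifferentiableAt ℝ (curve₂ ξ γ) s := by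
      obtain ⟨L, hL⟩ := (hξ.comp_div_const hγ).exists_isC1Curve (mul_pos hγ hT)
      exact hL.diff s hs
    have hY : HasDerivAt (fun s => s / γ) (1 / γ) s := (hasDerivAt_id s).div_const γ
    have h1 := hc21.hasDerivAt_comp hopen (hd.hasDerivAt.add_const z) hY (hmem z s hz hs)
    -- The factor `1 / γ` from the time scaling cancels the diffusivity, and the motion of the frame
    -- contributes the drift `ζ' u_x`.
    refine h1.congr_deriv ?_
    simp only [curve₂]
    rw [hu.regular.eqn _ (hmem z s hz hs)]
    field_simp
    ring
  · exact hc21.cont.comp hmap hmaps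
  · exact hc21.cont_x.comp hmap hmaps
  · exact hc21.cont_xx.comp hmap hmaps
  · exact fun z s hz hs => (hM₁ _ (hmem z s hz hs)).trans (le_max_left _ _)
  · exact fun z s hz hs => (hM₂ _ (hmem z s hz hs)).trans (le_max_right _ _)
  · intro s hs
    have ht := div_mem_Ioo_of_mem hγ hs
    rw [← hu.boundary _ ht]
    have hcl := hu.regular.cont_closure (ξ (s / γ), s / γ)
      (mem_closure_rightRegion hT hξc (Ioo_subset_Icc_self ht) le_rfl)
    refine hcl.tendsto.comp (f := fun z => (ξ (s / γ) + z, s / γ))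
      (tendsto_nhdsWithin_iff.2 ⟨?_, ?_⟩)
    · have h1 : Continuous fun z : ℝ => (ξ (s / γ) + z, s / γ) := by fun_prop
      have h2 := h1.tendsto 0
      rw [add_zero] at h2
      exact h2.mono_left nhdsWithin_le_nhds
    · filter_upwards [self_mem_nhdsWithin] with z hz using subset_closure (hmem z s hz hs)
  · exact fun s hs => hf _ (div_mem_Ioo_of_mem hγ hs)
  · intro z hz
    rw [← hu.initial z hz]
    have hcl := hu.regular.cont_closure (z, 0)
      (mem_closure_rightRegion hT hξc ⟨le_rfl, hT.le⟩ (by rw [hξ0]; exact hz.le))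
    refine hcl.tendsto.comp (f := fun s => (ξ (s / γ) + z, s / γ))
      (tendsto_nhdsWithin_iff.2 ⟨?_, ?_⟩)
    · have h1 := tendsto_nhdsGT_zero_of_continuousOn (mul_pos hγ hT)
        (hξ.comp_div_const hγ).continuousOn
      simp only [zero_div, hξ0] at h1
      have h2 : Tendsto (fun s => s / γ) (𝓝[>] 0) (𝓝 0) := by
        have := (by fun_prop : Continuous fun s : ℝ => s / γ).tendsto 0
        rw [zero_div] at this
        exact this.mono_left nhdsWithin_le_nhds
      have h3 := h1.add_const z
      rw [zero_add] at h3
      exact h3.prodMk_nhds h2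
    · filter_upwards [Ioo_mem_nhdsGT (mul_pos hγ hT)] with s hs
        using subset_closure (hmem z s hz hs)

/-- Continuity up to the corner makes the initial and the boundary values compatible. -/
theorem SolvesForward.tendsto_initial {γ T : ℝ} {ξ u₀ g : ℝ → ℝ} {u : ℝ → ℝ → ℝ}
    (hu : SolvesForward γ ξ T u₀ g u) (hT : 0 < T) (hξ : ContinuousOn ξ (Icc 0 T))
    (hξ0 : ξ 0 = 0) (hg : ContinuousOn g (Icc 0 T)) : Tendsto u₀ (𝓝[>] 0) (𝓝 (g 0)) := by
  have hcl := hu.regular.cont_closure (0, 0)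
    (mem_closure_rightRegion hT hξ ⟨le_rfl, hT.le⟩ hξ0.le)
  have hid : Tendsto (fun t : ℝ => t) (𝓝[>] 0) (𝓝 0) := nhdsWithin_le_nhds
  have h1 : Tendsto g (𝓝[>] 0) (𝓝 (u 0 0)) := by
    have h2 : Tendsto (fun t => u (ξ t) t) (𝓝[>] 0) (𝓝 (u 0 0)) := by
      refine hcl.tendsto.comp (f := fun t => (ξ t, t)) (tendsto_nhdsWithin_iff.2 ⟨?_, ?_⟩)
      · have h3 := tendsto_nhdsGT_zero_of_continuousOn hT hξ
        rw [hξ0] at h3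
        exact h3.prodMk_nhds hid
      · filter_upwards [Ioo_mem_nhdsGT hT] with t ht
        exact mem_closure_rightRegion hT hξ (Ioo_subset_Icc_self ht) le_rfl
    refine h2.congr' ?_
    filter_upwards [Ioo_mem_nhdsGT hT] with t ht using hu.boundary t ht
  have h2 : g 0 = u 0 0 :=
    tendsto_nhds_unique (tendsto_nhdsGT_zero_of_continuousOn hT hg) h1
  rw [h2]
  have h3 : Tendsto (fun x => u x 0) (𝓝[>] 0) (𝓝 (u 0 0)) := by
    refine hcl.tendsto.comp (f := fun x => (x, 0)) (tendsto_nhdsWithin_iff.2 ⟨?_, ?_⟩)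
    · exact hid.prodMk_nhds tendsto_const_nhds
    · filter_upwards [self_mem_nhdsWithin] with x hx
      exact mem_closure_rightRegion hT hξ ⟨le_rfl, hT.le⟩ (by rw [hξ0]; exact le_of_lt hx)
  refine h3.congr' ?_
  filter_upwards [self_mem_nhdsWithin] with x hx using hu.initial x hx

theorem datum₂_eq_fluxDatum (ξ : ℝ → ℝ) (γ : ℝ) (u₀ g : ℝ → ℝ) :
    datum₂ ξ γ u₀ g = fluxDatum (curve₂ ξ γ) u₀ fun s => g (s / γ) := by
  have h : ∀ s, deriv (fun s => g (s / γ)) s = deriv g (s / γ) / γ := by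
    intro s
    have := deriv_comp_mul_left γ⁻¹ g s
    simp_rw [inv_mul_eq_div, smul_eq_mul, inv_mul_eq_div] at this
    exact this
  funext τ
  unfold datum₂ fluxDatum
  simp_rw [h]

theorem forward_flux {T γ : ℝ} {ξ u₀ g : ℝ → ℝ} {u : ℝ → ℝ → ℝ} (hT : 0 < T)
    (hξ : ContDiffOn ℝ 1 ξ (Icc 0 T)) (hξ0 : ξ 0 = 0) (hγ : 0 < γ)
    (hu₀ : ContDiffOn ℝ 1 u₀ (Ici 0)) (hu₀i : IntegrableOn (deriv u₀) (Ioi 0))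
    (hg : ContDiffOn ℝ 1 g (Icc 0 T)) (hu : SolvesForward γ ξ T u₀ g u) :
    ∃ f : ℝ → ℝ,
      IsVolterraSolution (kernel₂ ξ γ) (datum₂ ξ γ u₀ g) (γ * T) f ∧
      Tendsto (datum₂ ξ γ u₀ g) (𝓝[>] 0) (𝓝 (π * f 0)) ∧
      (∀ f' : ℝ → ℝ, IsVolterraSolution (kernel₂ ξ γ) (datum₂ ξ γ u₀ g) (γ * T) f' →
        EqOn f' f (Icc 0 (γ * T))) ∧
      ∀ t ∈ Ioo 0 T,
        Tendsto (fun η => partialX u (ξ t + η) t) (𝓝[>] 0) (𝓝 (f (γ * t))) := by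
  have hS : 0 < γ * T := mul_pos hγ hT
  obtain ⟨L, hL⟩ := (hξ.comp_div_const hγ).exists_isC1Curve hS
  obtain ⟨L', hL'⟩ := (hg.comp_div_const hγ).exists_isC1Curve hS
  obtain ⟨f, M, H⟩ := hu.exists_isFlatSolution hγ hT hξ hξ0
  have hd : ∀ z : ℝ, 0 < z → derivWithin u₀ (Ici 0) z = deriv u₀ z := fun z hz =>
    derivWithin_of_mem_nhds (Ici_mem_nhds hz)
  -- The data is smooth only on the closed half-line, so the limiting slope is the one-sided
  -- derivative at `0`; the two-sided one carries no information there.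
  have hl : Tendsto (deriv u₀) (𝓝[>] 0) (𝓝 (derivWithin u₀ (Ici 0) 0)) := by
    have h1 := hu₀.continuousOn_derivWithin (uniqueDiffOn_Ici 0) le_rfl 0 self_mem_Ici
    refine (h1.tendsto.mono_left (nhdsWithin_mono _ Ioi_subset_Ici_self)).congr' ?_
    filter_upwards [self_mem_nhdsWithin] with z hz using hd z hz
  have hdiff : ∀ z : ℝ, 0 < z → DifferentiableAt ℝ u₀ z := fun z hz =>
    (hu₀.differentiableOn one_ne_zero z (mem_Ici.2 hz.le)).differentiableAt (Ici_mem_nhds hz)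
  have h0 := hu.tendsto_initial hT hξ.continuousOn hξ0 hg.continuousOn
  obtain ⟨F, hF, hFf⟩ := H.exists_volterraSolution hS hL (by simp [curve₂, hξ0]) hL' hdiff
    (by simpa using h0) hu₀i hl
  rw [datum₂_eq_fluxDatum]
  refine ⟨F, hF, hF.tendsto_datum hL hS, fun f' hf' => IsVolterraSolution.eqOn hf' hF hL hS, ?_⟩
  intro t ht
  have hmem : γ * t ∈ Ioo 0 (γ * T) :=
    ⟨mul_pos hγ ht.1, mul_lt_mul_of_pos_left ht.2 hγ⟩
  have h1 := H.flux (γ * t) hmem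
  rw [mul_div_cancel_left₀ _ hγ.ne'] at h1
  rw [hFf _ hmem]
  exact h1

/-! ### The backward problem by reflection -/

section

variable {γ T K : ℝ} {ξ uT g : ℝ → ℝ} {u : ℝ → ℝ → ℝ}

theorem partialX_reflect (u : ℝ → ℝ → ℝ) (K T x t : ℝ) :
    partialX (fun x t => u (K - x) (T - t)) x t = -partialX u (K - x) (T - t) :=
  deriv_comp_const_sub (f := fun y => u y (T - t)) K x

theorem partialXX_reflect (u : ℝ → ℝ → ℝ) (K T x t : ℝ) :
    partialXX (fun x t => u (K - x) (T - t)) x t = partialXX u (K - x) (T - t) := by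
  unfold partialXX
  simp_rw [partialX_reflect]
  rw [deriv.fun_neg, deriv_comp_const_sub (f := fun y => partialX u y (T - t)), neg_neg]

theorem partialT_reflect (u : ℝ → ℝ → ℝ) (K T x t : ℝ) :
    partialT (fun x t => u (K - x) (T - t)) x t = -partialT u (K - x) (T - t) :=
  deriv_comp_const_sub (f := fun s => u (K - x) s) T t

theorem const_sub_mem_Ioo {t : ℝ} (ht : t ∈ Ioo 0 T) : T - t ∈ Ioo 0 T :=
  ⟨by linarith [ht.2], by linarith [ht.1]⟩

/-- Reversing space and time turns the backward problem into a forward one. -/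
theorem SolvesBackward.reflect (hu : SolvesBackward γ ξ T K uT g u) :
    SolvesForward (-γ) (fun t => K - ξ (T - t)) T (fun x => uT (K - x)) (fun t => g (T - t))
      fun x t => u (K - x) (T - t) := by
  set ρ : ℝ × ℝ → ℝ × ℝ := fun p => (K - p.1, T - p.2) with hρ
  have hρc : Continuous ρ := by fun_prop
  have hmaps : MapsTo ρ (rightRegion (fun t => K - ξ (T - t)) T) (leftRegion ξ T) := by
    rintro ⟨x, t⟩ ⟨ht, hx⟩
    exact ⟨const_sub_mem_Ioo ht, by simp only [hρ] at hx ⊢; linarith⟩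
  have hc := hu.regular.c21
  refine ⟨⟨⟨?_, ?_, ?_, ?_, ?_, ?_, ?_⟩, ?_, ?_, ?_, ?_⟩, ?_, ?_, ?_⟩
  · intro p hp
    exact DifferentiableAt.comp (g := fun y => u y (T - p.2)) (f := fun y => K - y) p.1
      (hc.diff_x _ (hmaps hp)) (by fun_prop)
  · intro p hp
    simp_rw [partialX_reflect]
    exact (DifferentiableAt.comp (g := fun y => partialX u y (T - p.2)) (f := fun y => K - y) p.1
      (hc.diff_xx _ (hmaps hp)) (by fun_prop)).neg
  · intro p hp
    exact DifferentiableAt.comp (g := fun s => u (K - p.1) s) (f := fun s => T - s) p.2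
      (hc.diff_t _ (hmaps hp)) (by fun_prop)
  · exact hc.cont.comp hρc.continuousOn hmaps
  · simp_rw [partialX_reflect]
    exact (hc.cont_x.comp hρc.continuousOn hmaps).neg
  · simp_rw [partialXX_reflect]
    exact hc.cont_xx.comp hρc.continuousOn hmaps
  · simp_rw [partialT_reflect]
    exact (hc.cont_t.comp hρc.continuousOn hmaps).neg
  · exact hu.regular.cont_closure.comp hρc.continuousOn (hmaps.closure hρc)
  · obtain ⟨M, hM⟩ := hu.regular.bounded
    exact ⟨M, fun p hp => hM _ (hmaps hp)⟩
  · obtain ⟨M, hM⟩ := hu.regular.bounded_x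
    refine ⟨M, fun p hp => ?_⟩
    rw [partialX_reflect, abs_neg]
    exact hM _ (hmaps hp)
  · intro p hp
    rw [partialT_reflect, partialXX_reflect, hu.regular.eqn _ (hmaps hp), neg_mul]
  · intro t ht
    simp only [sub_sub_cancel]
    exact hu.boundary _ (const_sub_mem_Ioo ht)
  · intro x hx
    simp only [sub_zero]
    exact hu.final _ (by linarith)
  · intro t ht
    obtain ⟨l, hl⟩ := hu.trace _ (const_sub_mem_Ioo ht)
    refine ⟨-l, hl.neg.congr fun η => ?_⟩
    rw [partialX_reflect]
    congr 2
    ring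

/-- Reflection reverses the sign of the derivatives of both the final and the boundary data, which
accounts for the opposite signs in the two data terms. -/
theorem datum₁_eq_datum₂ {γ₀ : ℝ} :
    datum₁ ξ γ₀ T K uT g =
      datum₂ (fun t => K - ξ (T - t)) |γ₀| (fun x => uT (K - x)) fun t => g (T - t) := by
  funext τ
  unfold datum₁ datum₂ curve₁ curve₂
  simp_rw [deriv_comp_const_sub, mul_neg, neg_div, mul_neg, integral_neg,
    intervalIntegral.integral_neg]
  ring

end

end

theorem mainTheorem6
    (T : ℝ) (hT : 0 < T) (ξ : ℝ → ℝ) (hξ : ContDiffOn ℝ 1 ξ (Icc 0 T)) (hξ0 : ξ 0 = 0)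
    (K : ℝ) (hK : ξ T = K) (γ₀ γ₂ : ℝ) (hγ₀ : γ₀ < 0) (hγ₂ : 0 < γ₂) :
    (∀ (u₀ g : ℝ → ℝ) (u : ℝ → ℝ → ℝ),
      ContDiffOn ℝ 1 u₀ (Ici 0) → IntegrableOn (deriv u₀) (Ioi 0) →
      ContDiffOn ℝ 1 g (Icc 0 T) →
      SolvesForward γ₂ ξ T u₀ g u →
      ∃ f₂ : ℝ → ℝ,
        IsVolterraSolution (kernel₂ ξ γ₂) (datum₂ ξ γ₂ u₀ g) (γ₂ * T) f₂ ∧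
        Tendsto (datum₂ ξ γ₂ u₀ g) (𝓝[>] 0) (𝓝 (π * f₂ 0)) ∧
        (∀ f : ℝ → ℝ, IsVolterraSolution (kernel₂ ξ γ₂) (datum₂ ξ γ₂ u₀ g) (γ₂ * T) f →
          EqOn f f₂ (Icc 0 (γ₂ * T))) ∧
        ∀ t ∈ Ioo 0 T,
          Tendsto (fun η => partialX u (ξ t + η) t) (𝓝[>] 0) (𝓝 (f₂ (γ₂ * t)))) ∧
    (∀ (uT g : ℝ → ℝ) (u : ℝ → ℝ → ℝ),
      ContDiffOn ℝ 1 uT (Iic K) → IntegrableOn (deriv uT) (Iio K) →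
      ContDiffOn ℝ 1 g (Icc 0 T) →
      SolvesBackward γ₀ ξ T K uT g u →
      ∃ f₁ : ℝ → ℝ,
        IsVolterraSolution (kernel₁ ξ γ₀ T K) (datum₁ ξ γ₀ T K uT g) (|γ₀| * T) f₁ ∧
        Tendsto (datum₁ ξ γ₀ T K uT g) (𝓝[>] 0) (𝓝 (π * f₁ 0)) ∧
        (∀ f : ℝ → ℝ,
          IsVolterraSolution (kernel₁ ξ γ₀ T K) (datum₁ ξ γ₀ T K uT g) (|γ₀| * T) f →
          EqOn f f₁ (Icc 0 (|γ₀| * T))) ∧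
        ∀ t ∈ Ioo 0 T,
          Tendsto (fun η => partialX u (ξ t - η) t) (𝓝[>] 0) (𝓝 (-f₁ (|γ₀| * (T - t))))) := by
  refine ⟨fun u₀ g u hu₀ hu₀i hg hu => forward_flux hT hξ hξ0 hγ₂ hu₀ hu₀i hg hu, ?_⟩
  intro uT g u huT huTi hg hu
  have hrefl : ∀ {φ : ℝ → ℝ}, ContDiffOn ℝ 1 φ (Icc 0 T) →
      ContDiffOn ℝ 1 (fun t => φ (T - t)) (Icc 0 T) := fun hφ =>
    hφ.comp (f := fun t => T - t) (by fun_prop)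
      fun t ht => ⟨by linarith [ht.2], by linarith [ht.1]⟩
  have hu' := hu.reflect
  rw [← abs_of_neg hγ₀] at hu'
  have hderiv : IntegrableOn (deriv fun x => uT (K - x)) (Ioi 0) := by
    have h1 : IntegrableOn (fun x => deriv uT (K - x)) (Ioi 0) := by
      have h2 := (Measure.measurePreserving_sub_left volume K).integrableOn_comp_preimage
        (MeasurableEquiv.subLeft K).measurableEmbedding (f := deriv uT) (s := Iio K)
      have h3 : (fun x => K - x) ⁻¹' Iio K = Ioi 0 := by ext x; simp
      rw [h3] at h2
      exact h2.2 huTi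
    have h2 : (deriv fun x => uT (K - x)) = fun x => -deriv uT (K - x) :=
      funext fun x => deriv_comp_const_sub uT K x
    rw [h2]
    exact h1.neg
  obtain ⟨f, hf, hf0, huniq, hflux⟩ := forward_flux hT (contDiffOn_const.sub (hrefl hξ))
    (by simp [hK]) (abs_pos.2 hγ₀.ne)
    (huT.comp (f := fun x => K - x) (by fun_prop) fun x hx => by
      simp only [mem_Iic]; linarith [mem_Ici.1 hx]) hderiv (hrefl hg) hu'
  rw [datum₁_eq_datum₂]
  refine ⟨f, hf, hf0, huniq, fun t ht => ?_⟩
  -- The reflected time is `T - t`, and the space reversal gives the minus sign in front of the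
  -- flux.
  have h1 := (hflux (T - t) (const_sub_mem_Ioo ht)).neg
  refine h1.congr fun η => ?_
  rw [partialX_reflect, neg_neg, sub_sub_cancel]
  congr 1
  ring
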